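/- Let $(\Omega,\mathcal A,\mathbb P)$ be a probability space, $(E,\mathcal T)$ a measurable space, $X=(X_i)_{i\ge1}$ a stationary $E$-valued process, $T$ the shift on $E^{\mathbb N_+}$ and $d\ge 1$. For each $n\ge1$ let $S_n\Phi:E^{\mathbb N_+}\to\mathbb R^d$ be measurable, let $\mu_n$ be the law of $S_n\Phi(X)/n$, and put $\Lambda_n(\lambda)=\frac1n\log\int e^{n\langle\lambda,x\rangle}\,d\mu_n(x)$ for $\lambda\in\mathbb R^d$. Let $(k(n))_{n\ge1}$ be a nondecreasing sequence of positive integers, and for $\omega\in\Omega$ put $$\mu_n^\omega=\frac1{k(n)}\sum_{j=1}^{k(n)}\delta_{S_n\Phi(T^{(j-1)n}X(\omega))/n},\qquad \Lambda_n^\omega(\lambda)=\frac1n\log\int e^{n\langle\lambda,x\rangle}\,d\mu_n^\omega(x).$$ Let $\alpha_{X,0}=\frac12$ and, for $m\ge1$, $\alpha_{X,m}=\sup_{i\ge1}\sup\{|\mathbb P(U)\mathbb P(V)-\mathbb P(U\cap V)|: U\in\sigma(X_k:k\le i),\ V\in\sigma(X_j:j\ge i+m)\}$, and let $\alpha_X^{-1}(u)=\inf\{m\ge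 0:\alpha_{X,m}\le u\}$ for $u\in[0,1]$, with $\inf\emptyset=\infty$. Assume: * (A1'') for each $\lambda\in\mathbb R^d$ the limit $\Lambda(\lambda)=\lim_{n\to\infty}\Lambda_n(\lambda)$ exists as an extended real number, and the origin belongs to the interior of $\mathcal D_\Lambda=\{\lambda:\Lambda(\lambda)<\infty\}$; * (A2) $\int_0^1(\alpha_X^{-1}(u))^h\,du<\infty$ for all $h>0$; * (A3) there are functions $S_n\Phi_n:E^{\mathbb N_+}\to\mathbb R^d$, each depending only on the first $2n$ coordinates, with $\sup_{z\in E^{\mathbb N_+}}\|S_n\Phi(z)-S_n\Phi_n(z)\|/n\to0$ as $n\to\infty$. Let $\Lambda^*(x)=\sup_{\lambda\in\mathbb R^d}(\langle\lambda,x\rangle-\Lambda(\lambda))$ and $\mathcal D_{\Lambda^*}=\{x:\Lambda^*(x)<\infty\}$. Let $\mathcal F$ be the set of exposed points of $\Lambda^*$ with an exposing hyperplane in the interior of $\mathcal D_\Lambda$, that is, of those $y\in\mathbb R^d$ for which there is $\lambda$ in the interior of $\mathcal D_\Lambda$ with $\langle\lambda,y\rangle-\Lambda^*(y)>\langle\lambda,x\rangle-\Lambda^*(x)$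 for all $x\ne y$. Suppose that either $$\sup_{x\in\mathcal D_{\Lambda^*}}\Lambda^*(x)<\infty\quad\text{and}\quad\liminf_{n\to\infty}\frac{\log k(n)}n>\sup_{x\in\mathcal D_{\Lambda^*}}\Lambda^*(x),$$ or $\lim_{n\to\infty}\frac{\log k(n)}n=\infty$. Then $\Lambda$ does not take the value $-\infty$ and, with probability $1$: 1. $\Lambda_n^\omega$ converges to $\Lambda$ uniformly on every compact subset of the interior of $\mathcal D_\Lambda$; 2. for every closed $F\subset\mathbb R^d$, $\ \limsup_{n\to\infty}\frac1n\log\mu_n^\omega(F)\le-\inf_{x\in F}\Lambda^*(x)$; 3. for every open $G\subset\mathbb R^d$, $\ \liminf_{n\to\infty}\frac1n\log\mu_n^\omega(G)\ge-\inf_{x\in G\cap\mathcal F}\Lambda^*(x)$; 4. if moreover $\Lambda$ is lower semicontinuous and essentially smooth (that is: $\mathcal D_\Lambda$ has non-empty interior, $\Lambda$ is differentiable there, and $\|\nabla\Lambda(\lambda_m)\|\to\infty$ whenever $(\lambda_m)$ is a sequence in this interior that converges to a boundary point of it), then $\Lambda^*$ is a good rate function (it is lower semicontinuous with values in $[0,\infty]$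 and its level sets $\{\Lambda^*\le a\}$, $a\ge0$, are compact) and $(\mu_n^\omega)_{n\ge1}$ satisfies the large deviation principle with rate function $\Lambda^*$: for every set $\Gamma$ in the completed Borel $\sigma$-algebra of $\mathbb R^d$ (in particular for every Borel set), with interior $\Gamma^\circ$ and closure $\overline\Gamma$, $$-\inf_{x\in\Gamma^\circ}\Lambda^*(x)\le\liminf_{n\to\infty}\tfrac1n\log\mu_n^\omega(\Gamma)\le\limsup_{n\to\infty}\tfrac1n\log\mu_n^\omega(\Gamma)\le-\inf_{x\in\overline\Gamma}\Lambda^*(x).$$ -/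

import Mathlib

open MeasureTheory ProbabilityTheory Filter Topology
open scoped ENNReal

noncomputable section

namespace LocalFluctuations

/-! ### Strong mixing.
Sequences indexed by the positive integers are modelled on `ℕ`: the coordinate `X i` here is
the usual `X_{i+1}`. -/

/-- The strong mixing coefficient of two sub-sigma-algebras,
`sup { |P(U) P(V) - P(U ∩ V)| : U ∈ 𝒰, V ∈ 𝒱 }` (a supremum of real numbers in `[0,1]`). -/
def alphaCoeff {Ω : Type*} [MeasurableSpace Ω] (P : Measure Ω) (𝒰 𝒱 : MeasurableSpace Ω) : ℝ :=
  sSup {r : ℝ | ∃ U V : Set Ω, MeasurableSet[𝒰] U ∧ MeasurableSet[𝒱] V ∧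
    r = |P.real U * P.real V - P.real (U ∩ V)|}

/-- Rosenblatt's mixing coefficients of the sequence `X`: `1/2` for `m = 0`, and the supremum over
`i` of the coefficient between `σ(X_k : k ≤ i)` and `σ(X_j : j ≥ i + m)` for `m ≥ 1`. -/
def mixingCoeff {Ω E : Type*} [MeasurableSpace Ω] [mE : MeasurableSpace E] (P : Measure Ω)
    (X : ℕ → Ω → E) (m : ℕ) : ℝ :=
  if m = 0 then 1 / 2
  else ⨆ i : ℕ, alphaCoeff P (⨆ k ∈ Set.Iic i, mE.comap (X k))
    (⨆ j ∈ Set.Ici (i + m), mE.comap (X j))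

/-- The inverse `u ↦ inf { m : α_{X,m} ≤ u }`, equal to `∞` if there is no such `m`. -/
def mixingInv {Ω E : Type*} [MeasurableSpace Ω] [MeasurableSpace E] (P : Measure Ω)
    (X : ℕ → Ω → E) (u : ℝ) : ℝ≥0∞ :=
  ⨅ (m : ℕ) (_ : mixingCoeff P X m ≤ u), (m : ℝ≥0∞)

/-- The shift on sequences. -/
def shift {E : Type*} (x : ℕ → E) : ℕ → E := fun i => x (i + 1)

/-- The process `X` is stationary: its law on the sequence space is invariant under the shift. -/
def IsStationary {Ω E : Type*} [MeasurableSpace Ω] [MeasurableSpace E] (P : Measure Ω)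
    (X : ℕ → Ω → E) : Prop :=
  P.map (fun ω => shift (fun i => X i ω)) = P.map (fun ω i => X i ω)

/-- The function `g` of a sequence depends only on the first `N` coordinates. -/
def DependsOnFirst {E Y : Type*} (g : (ℕ → E) → Y) (N : ℕ) : Prop :=
  ∀ z z' : ℕ → E, (∀ i < N, z i = z' i) → g z = g z'

/-! ### The deterministic and the random measures -/

/-- The law of `S_n Φ(X) / n`. -/
def scaledLaw {Ω E Y : Type*} [MeasurableSpace Ω] [NormedAddCommGroup Y] [NormedSpace ℝ Y]
    [MeasurableSpace Y] (P : Measure Ω) (X : ℕ → Ω → E) (SΦ : ℕ → (ℕ → E) → Y) (n : ℕ) :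
    Measure Y :=
  P.map (fun ω => (n : ℝ)⁻¹ • SΦ n (fun i => X i ω))

/-- The empirical measure of the points `S_n Φ(T^{(j-1)n} x) / n`, `1 ≤ j ≤ k(n)`, along the
sequence `x` (the summation index below is `j - 1`). -/
def empiricalLaw {E Y : Type*} [NormedAddCommGroup Y] [NormedSpace ℝ Y] [MeasurableSpace Y]
    (SΦ : ℕ → (ℕ → E) → Y) (k : ℕ → ℕ) (x : ℕ → E) (n : ℕ) : Measure Y :=
  (k n : ℝ≥0∞)⁻¹ • ∑ j ∈ Finset.range (k n),
    Measure.dirac ((n : ℝ)⁻¹ • SΦ n (shift^[j * n] x))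

/-! ### Logarithmic moment generating functions and convex duality.
Functions with values in `ℝ ∪ {±∞}` are `EReal`-valued; `ENNReal.log` takes the values
`log 0 = -∞` and `log ∞ = ∞`. -/

/-- `(1/n) log ∫ exp (n ⟨l, x⟩) dμ(x)`. -/
def logMGF {d : ℕ} (μ : Measure (EuclideanSpace ℝ (Fin d))) (n : ℕ)
    (l : EuclideanSpace ℝ (Fin d)) : EReal :=
  ENNReal.log (∫⁻ x, ENNReal.ofReal (Real.exp (n * inner ℝ l x)) ∂μ) / (n : EReal)

/-- The domain `{l : L l < ∞}`. -/
def effDomain {Y : Type*} (L : Y → EReal) : Set Y := {l | L l < ⊤}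

/-- The Fenchel-Legendre transform. -/
def fenchel {d : ℕ} (L : EuclideanSpace ℝ (Fin d) → EReal) (x : EuclideanSpace ℝ (Fin d)) :
    EReal :=
  ⨆ l : EuclideanSpace ℝ (Fin d), ((inner ℝ l x : ℝ) : EReal) - L l

/-- The exposed points of the Fenchel-Legendre transform of `L` that have an exposing hyperplane
in the interior of the domain of `L`. -/
def exposedPoints {d : ℕ} (L : EuclideanSpace ℝ (Fin d) → EReal) :
    Set (EuclideanSpace ℝ (Fin d)) :=
  {y | ∃ l ∈ interior (effDomain L), ∀ x, x ≠ y →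
    ((inner ℝ l x : ℝ) : EReal) - fenchel L x < ((inner ℝ l y : ℝ) : EReal) - fenchel L y}

/-- Essential smoothness of a function with values in `ℝ ∪ {∞}`: the interior of the domain is
non-empty, the function is differentiable there, and it is steep. -/
structure EssentiallySmooth {d : ℕ} (L : EuclideanSpace ℝ (Fin d) → EReal) : Prop where
  nonempty : (interior (effDomain L)).Nonempty
  differentiable : ∀ l ∈ interior (effDomain L), DifferentiableAt ℝ (fun z => (L z).toReal) l
  steep : ∀ (u : ℕ → EuclideanSpace ℝ (Fin d)) (l : EuclideanSpace ℝ (Fin d)),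
    (∀ n, u n ∈ interior (effDomain L)) → l ∈ frontier (interior (effDomain L)) →
    Tendsto u atTop (𝓝 l) →
    Tendsto (fun n => ‖gradient (fun z => (L z).toReal) (u n)‖) atTop atTop

/-! ### Large deviation principles -/

/-- `I` is a good rate function: it is lower semicontinuous with values in `[0,∞]`, and its level
sets are compact. -/
structure IsGoodRateFunction {Y : Type*} [TopologicalSpace Y] (I : Y → EReal) : Prop where
  nonneg : ∀ x, 0 ≤ I x
  lowerSemicontinuous : LowerSemicontinuous I
  isCompact_level : ∀ a : ℝ, 0 ≤ a → IsCompact {x | I x ≤ (a : EReal)}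

/-- The large deviation bounds with rate function `I` for the sequence `(μ n)`, `n ≥ 1`, over all
sets of the completed Borel sigma-algebra. -/
def SatisfiesLDP {Y : Type*} [TopologicalSpace Y] [MeasurableSpace Y] (μ : ℕ → Measure Y)
    (I : Y → EReal) : Prop :=
  ∀ Γ : Set Y, (∀ n, 1 ≤ n → NullMeasurableSet Γ (μ n)) →
    -(⨅ x ∈ interior Γ, I x) ≤ liminf (fun n : ℕ => ENNReal.log (μ n Γ) / (n : EReal)) atTop ∧
    limsup (fun n : ℕ => ENNReal.log (μ n Γ) / (n : EReal)) atTop ≤ -(⨅ x ∈ closure Γ, I x)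

end LocalFluctuations

end

open LocalFluctuations

/-
For fixed `l`, the exponential moment of the random measure `μ_n^ω` has expectation equal to that
of `μ_n`, so Markov's inequality and the Borel–Cantelli lemma give `limsup Λ_n^ω(l) ≤ Λ(l)` almost
surely. For the reverse inequality, replace `S_n Φ` by functions of the first `2n` coordinates and
truncate the summands at `exp (n b)`. The moment at `p l`, for some `p > 1`, dominates what is cut
off, and the truncated sum concentrates by Chebyshev's inequality: since the process mixes faster
than every power, blocks that are `exp (n δ)` apart are independent up to an error which is
negligible on the exponential scale. A suitable `b` exists as soon as `Λ(p l) - p Λ(l) < (p - 1) κ`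
and eventually `k(n) ≥ exp (n κ)`. For a subgradient `x` of `Λ` at `p l`, the left-hand side is at
most `(p - 1) Λ*(x)`, and this is where the growth rate of `k(n)` is compared with `sup Λ*`.

Convexity turns convergence at countably many `l` into locally uniform convergence on the interior
of the domain of `Λ`. The proof of the Gärtner–Ellis theorem needs no more than that: exponential
tightness and coverings by half-spaces give the upper bound, tilting at exposed points the lower
one. If `Λ` is lower semicontinuous and essentially smooth, minimizing `Λ(l) + ε ‖l‖² / 2 - ⟨l, y⟩`
over `l` yields exposed points `y - ε l` that approximate `y` and satisfy `Λ*(y - ε l) ≤ Λ*(y)`.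
-/

namespace LocalFluctuations

/-! ### Exponential growth rates -/

section ExponentialRates

open ExpGrowth

lemma log_div_natCast_le_iff {z : ℝ≥0∞} {n : ℕ} (hn : 1 ≤ n) {A : ℝ} :
    ENNReal.log z / (n : EReal) ≤ A ↔ z ≤ ENNReal.ofReal (Real.exp (n * A)) := by
  rw [EReal.div_le_iff_le_mul (by exact_mod_cast hn) (EReal.natCast_ne_top n),
    ← ENNReal.log_strictMono.le_iff_le (a := z), ENNReal.log_ofReal_of_pos (Real.exp_pos _),
    Real.log_exp]
  push_cast
  rfl

lemma le_log_div_natCast_iff {z : ℝ≥0∞} {n : ℕ} (hn : 1 ≤ n) {A : ℝ} :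
    A ≤ ENNReal.log z / (n : EReal) ↔ ENNReal.ofReal (Real.exp (n * A)) ≤ z := by
  rw [EReal.le_div_iff_mul_le (by exact_mod_cast hn) (EReal.natCast_ne_top n),
    ← ENNReal.log_strictMono.le_iff_le (b := z), ENNReal.log_ofReal_of_pos (Real.exp_pos _),
    Real.log_exp, mul_comm]
  push_cast
  rfl

lemma eventually_lt_exp_of_expGrowthSup_lt {z : ℕ → ℝ≥0∞} {A : ℝ} (h : expGrowthSup z < A) :
    ∀ᶠ n : ℕ in atTop, z n < ENNReal.ofReal (Real.exp (n * A)) := by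
  filter_upwards [eventually_lt_of_limsup_lt h, eventually_ge_atTop 1] with n hn h1
  rwa [← not_le, ← le_log_div_natCast_iff h1, not_le]

lemma eventually_exp_lt_of_lt_expGrowthInf {z : ℕ → ℝ≥0∞} {A : ℝ} (h : A < expGrowthInf z) :
    ∀ᶠ n : ℕ in atTop, ENNReal.ofReal (Real.exp (n * A)) < z n := by
  filter_upwards [eventually_lt_of_lt_liminf h, eventually_ge_atTop 1] with n hn h1
  rwa [← not_le, ← log_div_natCast_le_iff h1, not_le]

lemma expGrowthSup_le_of_eventually_le_exp {z : ℕ → ℝ≥0∞} {A : ℝ}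
    (h : ∀ᶠ n : ℕ in atTop, z n ≤ ENNReal.ofReal (Real.exp (n * A))) : expGrowthSup z ≤ A :=
  limsup_le_of_le (by isBoundedDefault) <| by
    filter_upwards [h, eventually_ge_atTop 1] with n hn h1
    exact (log_div_natCast_le_iff h1).2 hn

lemma le_expGrowthInf_of_eventually_exp_le {z : ℕ → ℝ≥0∞} {A : ℝ}
    (h : ∀ᶠ n : ℕ in atTop, ENNReal.ofReal (Real.exp (n * A)) ≤ z n) : A ≤ expGrowthInf z :=
  le_liminf_of_le (by isBoundedDefault) <| by
    filter_upwards [h, eventually_ge_atTop 1] with n hn h1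
    exact (le_log_div_natCast_iff h1).2 hn

lemma eventually_const_le_natCast_mul {c : ℝ} (hc : 0 < c) (C : ℝ) :
    ∀ᶠ n : ℕ in atTop, C ≤ n * c :=
  (tendsto_natCast_atTop_atTop.atTop_mul_const hc).eventually_ge_atTop C

lemma eventually_const_mul_exp_le (C : ℝ) {a b : ℝ} (hab : a < b) :
    ∀ᶠ n : ℕ in atTop, C * Real.exp (n * a) ≤ Real.exp (n * b) := by
  filter_upwards [eventually_const_le_natCast_mul (sub_pos.2 hab) C] with n hn
  have h : Real.exp (n * b) = Real.exp (n * (b - a)) * Real.exp (n * a) := by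
    rw [← Real.exp_add]; ring_nf
  rw [h]
  gcongr
  linarith [Real.add_one_le_exp ((n : ℝ) * (b - a))]

lemma expGrowthInf_add_le (u v : ℕ → ℝ≥0∞) :
    expGrowthInf (u + v) ≤ expGrowthInf u ⊔ expGrowthSup v := by
  refine EReal.le_of_forall_lt_iff_le.1 fun A hA ↦ ?_
  obtain ⟨B, hB, hBA⟩ := EReal.lt_iff_exists_real_btwn.1 hA
  by_contra! hlt
  refine (le_sup_left.trans_lt hB).not_ge (le_expGrowthInf_of_eventually_exp_le ?_)
  filter_upwards [eventually_lt_exp_of_expGrowthSup_lt (le_sup_right.trans_lt hB),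
    eventually_exp_lt_of_lt_expGrowthInf hlt,
    eventually_const_mul_exp_le 2 (EReal.coe_lt_coe_iff.1 hBA)] with n hv huv h2
  have hsum : ENNReal.ofReal (Real.exp (n * B)) + v n < u n + v n :=
    calc ENNReal.ofReal (Real.exp (n * B)) + v n
        ≤ ENNReal.ofReal (Real.exp (n * B)) + ENNReal.ofReal (Real.exp (n * B)) := by gcongr
      _ = ENNReal.ofReal (2 * Real.exp (n * B)) := by
        rw [two_mul, ENNReal.ofReal_add (by positivity) (by positivity)]
      _ ≤ ENNReal.ofReal (Real.exp (n * A)) := ENNReal.ofReal_le_ofReal h2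
      _ < u n + v n := huv
  exact (lt_of_add_lt_add_right hsum).le

lemma expGrowthSup_ofReal_exp (B : ℝ) :
    expGrowthSup (fun n : ℕ ↦ ENNReal.ofReal (Real.exp (n * B))) = B := by
  rw [← expGrowthSup_exp (a := B)]
  congr 1 with n
  rw [← EReal.exp_coe, mul_comm]
  push_cast
  rfl

lemma expGrowthSup_exp_mul_le (B : ℝ) (u : ℕ → ℝ≥0∞) :
    expGrowthSup (fun n : ℕ ↦ ENNReal.ofReal (Real.exp (n * B)) * u n) ≤ B + expGrowthSup u := by
  refine (expGrowthSup_mul_le ?_ ?_).trans_eq (by rw [expGrowthSup_ofReal_exp B]) <;>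
    simp [expGrowthSup_ofReal_exp]

lemma expGrowthInf_exp_mul_le (B : ℝ) (u : ℕ → ℝ≥0∞) :
    expGrowthInf (fun n : ℕ ↦ ENNReal.ofReal (Real.exp (n * B)) * u n) ≤ B + expGrowthInf u := by
  refine (expGrowthInf_mul_le ?_ ?_).trans_eq (by rw [expGrowthSup_ofReal_exp B]) <;>
    simp [expGrowthSup_ofReal_exp]

lemma expGrowthSup_le_of_forall_eventually_le_exp_mul {u v : ℕ → ℝ≥0∞}
    (h : ∀ γ : ℝ, 0 < γ → ∀ᶠ n : ℕ in atTop, u n ≤ ENNReal.ofReal (Real.exp (n * γ)) * v n) :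
    expGrowthSup u ≤ expGrowthSup v := by
  refine EReal.le_of_forall_lt_iff_le.1 fun A hA ↦ ?_
  obtain ⟨B, hB, hBA⟩ := EReal.lt_iff_exists_real_btwn.1 hA
  calc expGrowthSup u ≤ ((A - B : ℝ) : EReal) + expGrowthSup v :=
        (expGrowthSup_eventually_monotone (h _ (sub_pos.2 (EReal.coe_lt_coe_iff.1 hBA)))).trans
          (expGrowthSup_exp_mul_le _ v)
    _ ≤ ((A - B : ℝ) : EReal) + B := by gcongr
    _ = A := by rw [← EReal.coe_add, sub_add_cancel]

lemma expGrowthInf_le_of_forall_eventually_le_exp_mul {u v : ℕ → ℝ≥0∞}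
    (h : ∀ γ : ℝ, 0 < γ → ∀ᶠ n : ℕ in atTop, u n ≤ ENNReal.ofReal (Real.exp (n * γ)) * v n) :
    expGrowthInf u ≤ expGrowthInf v := by
  refine EReal.le_of_forall_lt_iff_le.1 fun A hA ↦ ?_
  obtain ⟨B, hB, hBA⟩ := EReal.lt_iff_exists_real_btwn.1 hA
  calc expGrowthInf u ≤ ((A - B : ℝ) : EReal) + expGrowthInf v :=
        (expGrowthInf_eventually_monotone (h _ (sub_pos.2 (EReal.coe_lt_coe_iff.1 hBA)))).trans
          (expGrowthInf_exp_mul_le _ v)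
    _ ≤ ((A - B : ℝ) : EReal) + B := by gcongr
    _ = A := by rw [← EReal.coe_add, sub_add_cancel]

end ExponentialRates

/-! ### Exponential moments and extended-real convexity -/

section ExpMoment

variable {V : Type*} [NormedAddCommGroup V] [InnerProductSpace ℝ V] [MeasurableSpace V]

/-- The exponential moment `∫ exp (n ⟨l, x⟩) dμ(x)`, so that `logMGF μ n l` is `1 / n` times its
logarithm. -/
noncomputable def expMoment (μ : Measure V) (n : ℕ) (l : V) : ℝ≥0∞ :=
  ∫⁻ x, ENNReal.ofReal (Real.exp (n * inner ℝ l x)) ∂μ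

lemma expMoment_zero (μ : Measure V) (n : ℕ) : expMoment μ n 0 = μ Set.univ := by
  simp [expMoment]

variable [OpensMeasurableSpace V]

lemma measurable_ofReal_exp_mul_inner (n : ℕ) (l : V) :
    Measurable fun x : V ↦ ENNReal.ofReal (Real.exp (n * inner ℝ l x)) :=
  (ENNReal.continuous_ofReal.comp (by fun_prop)).measurable

lemma expMoment_combo_le (μ : Measure V) (n : ℕ) (l m : V) {a b : ℝ} (ha : 0 ≤ a) (hb : 0 ≤ b)
    (hab : a + b = 1) :
    expMoment μ n (a • l + b • m) ≤ expMoment μ n l ^ a * expMoment μ n m ^ b := by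
  refine le_trans (le_of_eq (lintegral_congr fun x ↦ ?_))
    (ENNReal.lintegral_mul_norm_pow_le (measurable_ofReal_exp_mul_inner n l).aemeasurable
      (measurable_ofReal_exp_mul_inner n m).aemeasurable ha hb hab)
  rw [ENNReal.ofReal_rpow_of_pos (Real.exp_pos _), ENNReal.ofReal_rpow_of_pos (Real.exp_pos _),
    ← ENNReal.ofReal_mul (by positivity), ← Real.exp_mul, ← Real.exp_mul, ← Real.exp_add,
    inner_add_left, real_inner_smul_left, real_inner_smul_left]
  ring_nf

lemma expMoment_combo_le_exp {μ : Measure V} {n : ℕ} {l m : V} {a b A B : ℝ} (ha : 0 ≤ a)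
    (hb : 0 ≤ b) (hab : a + b = 1) (hl : expMoment μ n l ≤ ENNReal.ofReal (Real.exp (n * A)))
    (hm : expMoment μ n m ≤ ENNReal.ofReal (Real.exp (n * B))) :
    expMoment μ n (a • l + b • m) ≤ ENNReal.ofReal (Real.exp (n * (a * A + b * B))) := by
  calc expMoment μ n (a • l + b • m)
      ≤ expMoment μ n l ^ a * expMoment μ n m ^ b := expMoment_combo_le μ n l m ha hb hab
    _ ≤ ENNReal.ofReal (Real.exp (n * A)) ^ a * ENNReal.ofReal (Real.exp (n * B)) ^ b := by gcongr
    _ = ENNReal.ofReal (Real.exp (n * (a * A + b * B))) := by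
      rw [ENNReal.ofReal_rpow_of_pos (Real.exp_pos _), ENNReal.ofReal_rpow_of_pos (Real.exp_pos _),
        ← ENNReal.ofReal_mul (by positivity), ← Real.exp_mul, ← Real.exp_mul, ← Real.exp_add]
      ring_nf

end ExpMoment

lemma coe_toReal_of_mem_effDomain {Y : Type*} {L : Y → EReal} (hbot : ∀ l, L l ≠ ⊥) {l : Y}
    (hl : l ∈ effDomain L) : ((L l).toReal : EReal) = L l :=
  EReal.coe_toReal (ne_of_lt hl) (hbot l)

lemma eq_top_of_notMem_effDomain {Y : Type*} {L : Y → EReal} {l : Y} (hl : l ∉ effDomain L) :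
    L l = ⊤ :=
  not_lt_top_iff.1 hl

/-- Convexity of a function with values in `[-∞, ∞]`. Strict upper bounds `A`, `B` of the two
values avoid the undefined sum `∞ - ∞`. -/
def IsEConvex {Y : Type*} [AddCommGroup Y] [Module ℝ Y] (L : Y → EReal) : Prop :=
  ∀ (l m : Y) (a b A B : ℝ), 0 ≤ a → 0 ≤ b → a + b = 1 → L l < A → L m < B →
    L (a • l + b • m) ≤ ((a * A + b * B : ℝ) : EReal)

namespace IsEConvex

section Module

variable {Y : Type*} [AddCommGroup Y] [Module ℝ Y] {L : Y → EReal}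

lemma convex_effDomain (h : IsEConvex L) : Convex ℝ (effDomain L) := by
  intro l hl m hm a b ha hb hab
  obtain ⟨A, hA, -⟩ := EReal.lt_iff_exists_real_btwn.1 hl
  obtain ⟨B, hB, -⟩ := EReal.lt_iff_exists_real_btwn.1 hm
  exact (h l m a b A B ha hb hab hA hB).trans_lt (EReal.coe_lt_top _)

lemma convexOn_toReal (h : IsEConvex L) (hbot : ∀ l, L l ≠ ⊥) :
    ConvexOn ℝ (effDomain L) (fun l ↦ (L l).toReal) := by
  refine ⟨h.convex_effDomain, fun l hl m hm a b ha hb hab ↦ le_of_forall_pos_le_add fun ε hε ↦ ?_⟩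
  have lt_add : ∀ l ∈ effDomain L, L l < ((L l).toReal + ε : ℝ) := fun l hl ↦ by
    conv_lhs => rw [← coe_toReal_of_mem_effDomain hbot hl]
    exact_mod_cast lt_add_of_pos_right _ hε
  have key := h l m a b _ _ ha hb hab (lt_add l hl) (lt_add m hm)
  rw [← coe_toReal_of_mem_effDomain hbot (h.convex_effDomain hl hm ha hb hab),
    EReal.coe_le_coe_iff] at key
  have hε' : a * ε + b * ε = ε := by rw [← add_mul, hab, one_mul]
  simp only [smul_eq_mul]
  linarith

end Module

section Normed

variable {Y : Type*} [NormedAddCommGroup Y] [NormedSpace ℝ Y] {L : Y → EReal}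

lemma ne_bot (h : IsEConvex L) {x : Y} (hx : x ∈ interior (effDomain L)) (hLx : L x ≠ ⊥) (l : Y) :
    L l ≠ ⊥ := by
  intro hl
  have hlim : Tendsto (fun t : ℝ ↦ x + t • (x - l)) (𝓝[>] 0) (𝓝 x) :=
    (Continuous.tendsto' (by fun_prop) 0 x (by simp)).mono_left nhdsWithin_le_nhds
  obtain ⟨t, ht, ht0 : (0 : ℝ) < t⟩ :=
    ((hlim.eventually (mem_interior_iff_mem_nhds.1 hx)).and self_mem_nhdsWithin).exists
  obtain ⟨B, hB, -⟩ := EReal.lt_iff_exists_real_btwn.1 ht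
  have hcombo : (t / (1 + t)) • l + (1 / (1 + t)) • (x + t • (x - l)) = x := by
    match_scalars
    all_goals field_simp
    ring
  refine hLx (le_bot_iff.1 (EReal.le_of_forall_lt_iff_le.1 fun C _ ↦ ?_))
  have key := h l (x + t • (x - l)) (t / (1 + t)) (1 / (1 + t)) (((1 + t) * C - B) / t) B
    (by positivity) (by positivity) (by field_simp; ring) (hl ▸ EReal.bot_lt_coe _) hB
  rw [hcombo] at key
  refine key.trans_eq (congrArg _ ?_)
  field_simp
  ring

end Normed

lemma exists_mem_interior_lt {d : ℕ} {L : EuclideanSpace ℝ (Fin d) → EReal} (h : IsEConvex L)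
    (hbot : ∀ l, L l ≠ ⊥) (hne : (interior (effDomain L)).Nonempty)
    {x : EuclideanSpace ℝ (Fin d)} {c : ℝ} (hc : c < fenchel L x) :
    ∃ l ∈ interior (effDomain L), c < inner ℝ l x - (L l).toReal := by
  obtain ⟨m, hm⟩ := hne
  obtain ⟨l, hl⟩ := lt_iSup_iff.1 hc
  have hlD : l ∈ effDomain L := by
    by_contra htop
    rw [eq_top_of_notMem_effDomain htop, EReal.sub_top] at hl
    exact not_lt_bot hl
  rw [← coe_toReal_of_mem_effDomain hbot hlD] at hl
  have hl' : c < inner ℝ l x - (L l).toReal := by exact_mod_cast hl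
  -- Move from `l` slightly towards the interior point `m`.
  have hlim : Tendsto (fun t : ℝ ↦ (1 - t) * (inner ℝ m x - (L m).toReal) +
      t * (inner ℝ l x - (L l).toReal)) (𝓝[<] 1) (𝓝 (inner ℝ l x - (L l).toReal)) :=
    (Continuous.tendsto' (by fun_prop) 1 _ (by ring)).mono_left nhdsWithin_le_nhds
  obtain ⟨t, ⟨ht, ht1 : t < 1⟩, ht0⟩ := (((hlim.eventually_const_lt hl').and
    self_mem_nhdsWithin).and (nhdsWithin_le_nhds (Ioi_mem_nhds one_pos))).exists
  refine ⟨(1 - t) • m + t • l, h.convex_effDomain.combo_interior_self_mem_interior hm hlD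
    (sub_pos.2 ht1) (le_of_lt ht0) (sub_add_cancel 1 t), ht.trans_le ?_⟩
  have key := (h.convexOn_toReal hbot).2 (interior_subset hm) hlD (sub_pos.2 ht1).le
    (le_of_lt ht0) (sub_add_cancel 1 t)
  simp only [smul_eq_mul] at key
  rw [inner_add_left, real_inner_smul_left, real_inner_smul_left]
  linarith

end IsEConvex

lemma isEConvex_of_tendsto {Y ι : Type*} [AddCommGroup Y] [Module ℝ Y] {p : Filter ι} [p.NeBot]
    {f : ι → Y → EReal} {L : Y → EReal} (hf : ∀ᶠ i in p, IsEConvex (f i))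
    (hlim : ∀ l, Tendsto (fun i ↦ f i l) p (𝓝 (L l))) : IsEConvex L := by
  intro l m a b A B ha hb hab hA hB
  refine le_of_tendsto (hlim _) ?_
  filter_upwards [hf, (hlim l).eventually_lt_const hA, (hlim m).eventually_lt_const hB]
    with i hi hl hm
  exact hi l m a b A B ha hb hab hl hm

section LogMGF

variable {d : ℕ}

lemma isEConvex_logMGF (μ : Measure (EuclideanSpace ℝ (Fin d))) {n : ℕ} (hn : 1 ≤ n) :
    IsEConvex (logMGF μ n) := fun _ _ _ _ _ _ ha hb hab hA hB ↦
  (log_div_natCast_le_iff hn).2 (expMoment_combo_le_exp ha hb hab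
    ((log_div_natCast_le_iff hn).1 hA.le) ((log_div_natCast_le_iff hn).1 hB.le))

lemma logMGF_zero (μ : Measure (EuclideanSpace ℝ (Fin d))) [IsProbabilityMeasure μ] (n : ℕ) :
    logMGF μ n 0 = 0 := by
  change ENNReal.log (expMoment μ n 0) / (n : EReal) = 0
  rw [expMoment_zero, measure_univ, ENNReal.log_one, EReal.zero_div]

end LogMGF

/-! ### Real convex functions -/

section ConvexFunctions

lemma tendstoLocallyUniformlyOn_of_lipschitzOnWith_of_tendsto_dense {Y : Type*}
    [PseudoMetricSpace Y] {U Q : Set Y} (hU : IsOpen U) (hUQ : U ⊆ closure Q) {f : ℕ → Y → ℝ}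
    {g : Y → ℝ}
    (hlip : ∀ x ∈ U, ∃ C : NNReal, ∃ s ∈ 𝓝 x, ∀ᶠ n in atTop, LipschitzOnWith C (f n) s)
    (hg : ContinuousOn g U) (hlim : ∀ q ∈ Q, Tendsto (fun n ↦ f n q) atTop (𝓝 (g q))) :
    TendstoLocallyUniformlyOn f g atTop U := by
  rw [Metric.tendstoLocallyUniformlyOn_iff]
  intro ε hε x hx
  obtain ⟨C, s, hs, hfs⟩ := hlip x hx
  obtain ⟨δ, hδ, hball⟩ := Metric.mem_nhds_iff.1 (inter_mem hs
    ((hg.continuousAt (hU.mem_nhds hx)).preimage_mem_nhds (Metric.ball_mem_nhds (g x)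
      (show 0 < ε / 8 by linarith))))
  set η : ℝ := min δ (ε / (8 * (C + 1)))
  have hη : 0 < η := lt_min hδ (by positivity)
  have hCη : C * (2 * η) ≤ ε / 4 := by
    have hη' : η ≤ ε / (8 * (C + 1)) := min_le_right _ _
    rw [le_div_iff₀ (by positivity)] at hη'
    nlinarith
  obtain ⟨q, hq, hxq⟩ := Metric.mem_closure_iff.1 (hUQ hx) η hη
  have mem_of_mem : ∀ y ∈ Metric.ball x η, y ∈ s ∧ dist (g y) (g x) < ε / 8 := fun y hy ↦
    hball (Metric.ball_subset_ball (min_le_left _ _) hy)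
  obtain ⟨hqs, hgq⟩ := mem_of_mem q (by rwa [Metric.mem_ball, dist_comm])
  refine ⟨Metric.ball x η, mem_nhdsWithin_of_mem_nhds (Metric.ball_mem_nhds x hη), ?_⟩
  filter_upwards [hfs, (hlim q hq).eventually (Metric.ball_mem_nhds _ (show 0 < ε / 8 by linarith))]
    with n hfn hfnq y hy
  obtain ⟨hys, hgy⟩ := mem_of_mem y hy
  have hyq : dist y q ≤ 2 * η := by
    linarith [dist_triangle y x q, Metric.mem_ball.1 hy]
  have hfyq : dist (f n y) (f n q) ≤ ε / 4 :=
    (hfn.dist_le_mul y hys q hqs).trans ((mul_le_mul_of_nonneg_left hyq C.2).trans hCη)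
  calc dist (g y) (f n y)
      ≤ dist (g y) (g x) + dist (g x) (g q) + dist (g q) (f n y) := dist_triangle4 ..
    _ ≤ dist (g y) (g x) + dist (g x) (g q) + (dist (f n q) (g q) + dist (f n y) (f n q)) := by
        gcongr
        rw [dist_comm (f n q) (g q), dist_comm (f n y)]
        exact dist_triangle ..
    _ < ε := by
        rw [dist_comm (g x)]
        linarith [Metric.mem_ball.1 hfnq]

variable {V : Type*} [NormedAddCommGroup V] [NormedSpace ℝ V]

lemma abs_le_of_convexOn_ball {f : V → ℝ} {q : V} {r M : ℝ} (hf : ConvexOn ℝ (Metric.ball q r) f)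
    (hM : ∀ y ∈ Metric.ball q r, f y ≤ M) {y : V} (hy : y ∈ Metric.ball q r) :
    |f y| ≤ |M| + 2 * |f q| := by
  have hmem : (2 : ℝ) • q - y ∈ Metric.ball q r := by
    rw [mem_ball_iff_norm] at hy ⊢
    rwa [two_smul, show q + q - y - q = -(y - q) by abel, norm_neg]
  have hmid := hf.2 hy hmem (show (0 : ℝ) ≤ 1 / 2 by norm_num) (show (0 : ℝ) ≤ 1 / 2 by norm_num)
    (by norm_num)
  rw [show (1 / 2 : ℝ) • y + (1 / 2 : ℝ) • ((2 : ℝ) • q - y) = q by module] at hmid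
  simp only [smul_eq_mul] at hmid
  rw [abs_le]
  constructor <;>
    linarith [hM y hy, hM _ hmem, neg_abs_le (f q), abs_nonneg (f q), le_abs_self M]

variable [FiniteDimensional ℝ V]

lemma subset_convexHull_of_subset_closure {U Q : Set V} (hU : IsOpen U) (hUQ : U ⊆ closure Q) :
    U ⊆ convexHull ℝ Q := by
  rcases U.eq_empty_or_nonempty with rfl | hne
  · exact Set.empty_subset _
  have hspan : affineSpan ℝ Q = ⊤ := by
    rw [eq_top_iff, ← hU.affineSpan_eq_top hne]
    exact affineSpan_le.2 (hUQ.trans (closure_minimal (subset_affineSpan ℝ Q)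
      (AffineSubspace.closed_of_finiteDimensional _)))
  calc U ⊆ interior (closure (convexHull ℝ Q)) :=
        interior_maximal (hUQ.trans (closure_mono (subset_convexHull ℝ Q))) hU
    _ = interior (convexHull ℝ Q) :=
        (convex_convexHull ℝ Q).interior_closure_eq_interior_of_nonempty_interior
          (interior_convexHull_nonempty_iff_affineSpan_eq_top.2 hspan)
    _ ⊆ convexHull ℝ Q := interior_subset

section DenseConvergence

variable {U Q : Set V} {f : ℕ → V → ℝ} {g : V → ℝ}

lemma exists_eventually_le_of_tendsto_dense (hU : IsOpen U) (hQU : Q ⊆ U) (hUQ : U ⊆ closure Q)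
    (hf : ∀ᶠ n in atTop, ConvexOn ℝ U (f n))
    (hlim : ∀ q ∈ Q, Tendsto (fun n ↦ f n q) atTop (𝓝 (g q))) {y : V} (hy : y ∈ U) :
    ∃ M : ℝ, ∀ᶠ n in atTop, f n y ≤ M := by
  have hUc : Convex ℝ U := hf.exists.choose_spec.1
  have hconv : Convex ℝ {y | y ∈ U ∧ ∃ M : ℝ, ∀ᶠ n in atTop, f n y ≤ M} := by
    rintro y ⟨hy, M, hM⟩ z ⟨hz, N, hN⟩ a b ha hb hab
    refine ⟨hUc hy hz ha hb hab, a • M + b • N, ?_⟩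
    filter_upwards [hf, hM, hN] with n hfn hfM hfN
    exact (hfn.2 hy hz ha hb hab).trans (by gcongr)
  have hQ : Q ⊆ {y | y ∈ U ∧ ∃ M : ℝ, ∀ᶠ n in atTop, f n y ≤ M} := fun q hq ↦
    ⟨hQU hq, g q + 1, (hlim q hq).eventually_le_const (lt_add_one _)⟩
  exact (convexHull_min hQ hconv (subset_convexHull_of_subset_closure hU hUQ hy)).2

lemma exists_nhds_eventually_forall_le (hU : IsOpen U) (hf : ∀ᶠ n in atTop, ConvexOn ℝ U (f n))
    (hbdd : ∀ y ∈ U, ∃ M : ℝ, ∀ᶠ n in atTop, f n y ≤ M) {x : V} (hx : x ∈ U) :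
    ∃ M : ℝ, ∃ s ∈ 𝓝 x, s ⊆ U ∧ ∀ᶠ n in atTop, ∀ y ∈ s, f n y ≤ M := by
  obtain ⟨b, hxb, hbU⟩ := exists_mem_interior_convexHull_affineBasis (hU.mem_nhds hx)
  choose M hM using fun i ↦ hbdd (b i) (hbU (subset_convexHull ℝ _ (Set.mem_range_self i)))
  obtain ⟨M', hM'⟩ := (Set.finite_range M).bddAbove
  refine ⟨M', convexHull ℝ (Set.range b), mem_interior_iff_mem_nhds.1 hxb, hbU, ?_⟩
  filter_upwards [hf, eventually_all.2 hM] with n hfn hfM y hy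
  obtain ⟨_, ⟨i, rfl⟩, hyi⟩ := (hfn.subset hbU (convex_convexHull ℝ _)).exists_ge_of_mem_convexHull
    (subset_convexHull ℝ _) hy
  exact hyi.trans ((hfM i).trans (hM' (Set.mem_range_self i)))

lemma eventually_lipschitzOnWith_of_tendsto_dense (hU : IsOpen U) (hQU : Q ⊆ U)
    (hUQ : U ⊆ closure Q) (hf : ∀ᶠ n in atTop, ConvexOn ℝ U (f n))
    (hlim : ∀ q ∈ Q, Tendsto (fun n ↦ f n q) atTop (𝓝 (g q))) {x : V} (hx : x ∈ U) :
    ∃ C : NNReal, ∃ s ∈ 𝓝 x, ∀ᶠ n in atTop, LipschitzOnWith C (f n) s := by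
  obtain ⟨M, s, hs, hsU, hM⟩ := exists_nhds_eventually_forall_le hU hf
    (fun y hy ↦ exists_eventually_le_of_tendsto_dense hU hQU hUQ hf hlim hy) hx
  obtain ⟨r, hr, hrs⟩ := Metric.mem_nhds_iff.1 hs
  obtain ⟨q, hq, hxq⟩ := Metric.mem_closure_iff.1 (hUQ hx) (r / 4) (by linarith)
  have hqs : Metric.ball q (r / 2) ⊆ s :=
    (Metric.ball_subset_ball' (by rw [dist_comm]; linarith)).trans hrs
  refine ⟨(2 * (|M| + 2 * (|g q| + 1)) / (r / 4)).toNNReal, Metric.ball q (r / 2 - r / 4),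
    Metric.isOpen_ball.mem_nhds (by rw [Metric.mem_ball]; linarith), ?_⟩
  filter_upwards [hf, hM, (hlim q hq).abs.eventually_le_const (lt_add_one _)] with n hfn hfM hfq
  have hconv := hfn.subset (hqs.trans hsU) (convex_ball _ _)
  refine hconv.lipschitzOnWith_of_abs_le (by linarith) fun y hy ↦ ?_
  linarith [abs_le_of_convexOn_ball hconv (fun z hz ↦ hfM z (hqs hz)) hy]

lemma tendstoUniformlyOn_of_tendsto_dense (hU : IsOpen U) (hQU : Q ⊆ U) (hUQ : U ⊆ closure Q)
    (hf : ∀ᶠ n in atTop, ConvexOn ℝ U (f n)) (hg : ContinuousOn g U)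
    (hlim : ∀ q ∈ Q, Tendsto (fun n ↦ f n q) atTop (𝓝 (g q))) {K : Set V} (hK : IsCompact K)
    (hKU : K ⊆ U) : TendstoUniformlyOn f g atTop K :=
  (tendstoLocallyUniformlyOn_iff_forall_isCompact hU).1
    (tendstoLocallyUniformlyOn_of_lipschitzOnWith_of_tendsto_dense hU hUQ
      (fun _ hx ↦ eventually_lipschitzOnWith_of_tendsto_dense hU hQU hUQ hf hlim hx) hg hlim)
    K hKU hK

end DenseConvergence

lemma exists_continuousLinearMap_forall_add_le {V : Type*} [NormedAddCommGroup V]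
    [NormedSpace ℝ V] {U : Set V} (hU : IsOpen U) {f : V → ℝ} (hf : ConvexOn ℝ U f)
    (hcont : ContinuousOn f U) {x : V} (hx : x ∈ U) :
    ∃ φ : V →L[ℝ] ℝ, ∀ y ∈ U, f x + φ (y - x) ≤ f y := by
  have hopen : IsOpen {p : V × ℝ | p.1 ∈ U ∧ f p.1 < p.2} := by
    have hsub : ContinuousOn (fun p : V × ℝ ↦ p.2 - f p.1) (Prod.fst ⁻¹' U) :=
      continuousOn_snd.sub (hcont.comp continuousOn_fst fun p hp ↦ hp)
    simpa only [Set.preimage, Set.mem_Ioi, sub_pos, Set.ofPred_and] using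
      hsub.isOpen_inter_preimage (hU.preimage continuous_fst) (isOpen_Ioi (a := (0 : ℝ)))
  obtain ⟨ψ, hψ⟩ := geometric_hahn_banach_open_point hf.convex_strict_epigraph hopen
    (x := (x, f x)) (by simp)
  have hsplit : ∀ y ∈ U, ∀ t, f y < t → ψ (y - x, 0) + (t - f x) * ψ (0, 1) < 0 := by
    intro y hy t ht
    have key := hψ (y, t) ⟨hy, ht⟩
    rw [← sub_neg, ← map_sub, show ((y, t) - (x, f x) : V × ℝ) =
      (y - x, 0) + (t - f x) • ((0, 1) : V × ℝ) by simp, map_add, map_smul] at key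
    exact key
  have hneg : ψ (0, 1) < 0 := by
    simpa [Prod.mk_zero_zero] using hsplit x hx (f x + 1) (lt_add_one _)
  refine ⟨(-(ψ (0, 1))⁻¹) • ψ.comp (ContinuousLinearMap.inl ℝ V ℝ), fun y hy ↦
    le_of_forall_gt_imp_ge_of_dense fun t ht ↦ ?_⟩
  have key : -(ψ (0, 1))⁻¹ * ψ (y - x, 0) < t - f x := by
    rw [neg_mul, ← div_eq_inv_mul, neg_lt, lt_div_iff_of_neg hneg]
    linarith [hsplit y hy t ht]
  simp only [_root_.smul_apply, ContinuousLinearMap.comp_apply, ContinuousLinearMap.inl_apply,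
    smul_eq_mul]
  linarith

end ConvexFunctions

/-! ### Gärtner–Ellis bounds -/

section GartnerEllis

open ExpGrowth

section InnerProductSpace

variable {V : Type*} [NormedAddCommGroup V] [InnerProductSpace ℝ V]

lemma exists_finset_isBounded_polar [FiniteDimensional ℝ V] {U : Set V} (hU : U ∈ 𝓝 0)
    (b : V → ℝ) :
    ∃ T : Finset V, ↑T ⊆ U ∧ Bornology.IsBounded {x : V | ∀ l ∈ T, inner ℝ l x ≤ b l} := by
  classical
  obtain ⟨e, h0, heU⟩ := exists_mem_interior_convexHull_affineBasis hU
  obtain ⟨r, hr, hball⟩ := Metric.mem_nhds_iff.1 (mem_interior_iff_mem_nhds.1 h0)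
  obtain ⟨M, hM⟩ := (Set.finite_range fun i ↦ b (e i)).bddAbove
  refine ⟨Finset.univ.image e, ?_, isBounded_iff_forall_norm_le.2 ⟨M / (r / 2), fun x hx ↦ ?_⟩⟩
  · rw [Finset.coe_image, Finset.coe_univ, Set.image_univ]
    exact (subset_convexHull ℝ _).trans heU
  have hhull : convexHull ℝ (Set.range e) ⊆ {l | inner ℝ l x ≤ M} := by
    refine convexHull_min ?_ (convex_halfSpace_le (f := fun l ↦ inner ℝ l x)
      ⟨fun _ _ ↦ inner_add_left .., fun _ _ ↦ real_inner_smul_left ..⟩ M)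
    rintro _ ⟨i, rfl⟩
    exact (hx _ (Finset.mem_image_of_mem e (Finset.mem_univ i))).trans
      (hM (Set.mem_range_self i))
  have hmem : (r / 2 * ‖x‖⁻¹) • x ∈ Metric.ball (0 : V) r := by
    rw [mem_ball_zero_iff, norm_smul, norm_mul, norm_inv, norm_norm, mul_assoc,
      Real.norm_of_nonneg (by positivity)]
    nlinarith [inv_mul_le_one (a := ‖x‖)]
  have hle : inner ℝ ((r / 2 * ‖x‖⁻¹) • x) x ≤ M := hhull (hball hmem)
  rw [real_inner_smul_left, real_inner_self_eq_norm_mul_norm, mul_assoc, ← mul_assoc ‖x‖⁻¹,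
    inv_mul_mul_self] at hle
  rwa [le_div_iff₀ (by positivity), mul_comm]

lemma exists_finite_halfSpace_cover [FiniteDimensional ℝ V] {U : Set V} (hU : U ∈ 𝓝 0)
    (L : V → ℝ) {F : Set V} (hF : IsClosed F) {c : ℝ}
    (hc : ∀ x ∈ F, ∃ l ∈ U, c < inner ℝ l x - L l) :
    ∃ T ⊆ U ×ˢ Set.Ioi c, T.Finite ∧ F ⊆ ⋃ p ∈ T, {x | L p.1 + p.2 < inner ℝ p.1 x} := by
  have : ProperSpace V := FiniteDimensional.proper_real V
  obtain ⟨T₀, hT₀U, hT₀⟩ := exists_finset_isBounded_polar hU fun l ↦ L l + (c + 1)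
  have hcomp : IsCompact (F ∩ {x | ∀ l ∈ T₀, inner ℝ l x ≤ L l + (c + 1)}) := by
    refine Metric.isCompact_of_isClosed_isBounded (hF.inter ?_)
      (hT₀.subset Set.inter_subset_right)
    simp only [Set.ofPred_forall]
    exact isClosed_biInter fun l _ ↦ isClosed_le (by fun_prop) continuous_const
  obtain ⟨T₁, hT₁, hT₁fin, hcover⟩ := hcomp.elim_finite_subcover_image (b := U ×ˢ Set.Ioi c)
    (c := fun p ↦ {x | L p.1 + p.2 < inner ℝ p.1 x})
    (fun p _ ↦ isOpen_lt continuous_const (by fun_prop)) fun x hx ↦ by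
      obtain ⟨l, hl, hlx⟩ := hc x hx.1
      obtain ⟨c', hcc', hc'⟩ := exists_between hlx
      exact Set.mem_iUnion₂.2 ⟨(l, c'), ⟨hl, hcc'⟩, lt_sub_iff_add_lt'.1 hc'⟩
  refine ⟨(fun l ↦ (l, c + 1)) '' T₀ ∪ T₁, Set.union_subset ?_ hT₁,
    (T₀.finite_toSet.image _).union hT₁fin, fun x hx ↦ ?_⟩
  · rintro _ ⟨l, hl, rfl⟩
    exact ⟨hT₀U hl, lt_add_one c⟩
  · rw [Set.biUnion_union, Set.biUnion_image]
    by_cases hxT₀ : ∀ l ∈ T₀, inner ℝ l x ≤ L l + (c + 1)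
    · exact Or.inr (hcover ⟨hx, hxT₀⟩)
    · push Not at hxT₀
      exact Or.inl (Set.mem_iUnion₂.2 (by simpa using hxT₀))

variable [MeasurableSpace V]

section Upper

variable [OpensMeasurableSpace V]

lemma measure_halfSpace_le (μ : Measure V) (n : ℕ) (l : V) (B : ℝ) :
    μ {x | B < inner ℝ l x} ≤ ENNReal.ofReal (Real.exp (n * -B)) * expMoment μ n l := by
  calc μ {x | B < inner ℝ l x}
      ≤ μ {x | ENNReal.ofReal (Real.exp (n * B)) ≤
          ENNReal.ofReal (Real.exp (n * inner ℝ l x))} := by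
        gcongr with x
        intro hx
        gcongr
    _ ≤ expMoment μ n l / ENNReal.ofReal (Real.exp (n * B)) :=
        meas_ge_le_lintegral_div (measurable_ofReal_exp_mul_inner n l).aemeasurable
          (by positivity) ENNReal.ofReal_ne_top
    _ = ENNReal.ofReal (Real.exp (n * -B)) * expMoment μ n l := by
        rw [mul_neg, Real.exp_neg, ENNReal.ofReal_inv_of_pos (Real.exp_pos _),
          ENNReal.div_eq_inv_mul]

lemma expGrowthSup_measure_lt_of_isClosed [FiniteDimensional ℝ V] {ρ : ℕ → Measure V} {U : Set V}
    (hU : U ∈ 𝓝 0) {L : V → ℝ} (hL : ∀ l ∈ U, expGrowthSup (fun n ↦ expMoment (ρ n) n l) ≤ L l)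
    {F : Set V} (hF : IsClosed F) {c : ℝ} (hc : ∀ x ∈ F, ∃ l ∈ U, c < inner ℝ l x - L l) :
    expGrowthSup (fun n ↦ ρ n F) < (-c : ℝ) := by
  obtain ⟨T, hT, hTfin, hcover⟩ := exists_finite_halfSpace_cover hU L hF hc
  have hhalf : ∀ p ∈ hTfin.toFinset,
      expGrowthSup (fun n ↦ ρ n {x | L p.1 + p.2 < inner ℝ p.1 x}) < (-c : ℝ) := by
    intro p hp
    obtain ⟨hpU, hpc⟩ := hT (hTfin.mem_toFinset.1 hp)
    calc expGrowthSup (fun n ↦ ρ n {x | L p.1 + p.2 < inner ℝ p.1 x})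
        ≤ expGrowthSup (fun n : ℕ ↦
            ENNReal.ofReal (Real.exp (n * -(L p.1 + p.2))) * expMoment (ρ n) n p.1) :=
          expGrowthSup_monotone fun n ↦ measure_halfSpace_le (ρ n) n p.1 _
      _ ≤ (-(L p.1 + p.2) : ℝ) + (L p.1 : EReal) :=
          (expGrowthSup_exp_mul_le _ _).trans (by gcongr; exact hL p.1 hpU)
      _ < (-c : ℝ) := by
          norm_cast
          linarith [Set.mem_Ioi.1 hpc]
  calc expGrowthSup (fun n ↦ ρ n F)
      ≤ expGrowthSup (∑ p ∈ hTfin.toFinset, fun n ↦ ρ n {x | L p.1 + p.2 < inner ℝ p.1 x}) := by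
        refine expGrowthSup_monotone fun n ↦ ?_
        rw [Finset.sum_apply]
        refine (measure_mono hcover).trans ?_
        simpa only [hTfin.mem_toFinset] using measure_biUnion_finset_le hTfin.toFinset _
    _ < (-c : ℝ) := by
        rw [expGrowthSup_sum, ← Finset.sup_eq_iSup, Finset.sup_lt_iff (EReal.bot_lt_coe _)]
        exact hhalf

end Upper

/-- The exponential tilt `exp (n ⟨l, x⟩) dμ(x)` of a measure, without normalisation, as opposed to
`Measure.tilted`. -/
noncomputable def expTilt (μ : Measure V) (n : ℕ) (l : V) : Measure V :=
  μ.withDensity fun x ↦ ENNReal.ofReal (Real.exp (n * inner ℝ l x))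

variable [OpensMeasurableSpace V]

lemma expMoment_expTilt (μ : Measure V) (n : ℕ) (l m : V) :
    expMoment (expTilt μ n l) n m = expMoment μ n (l + m) := by
  rw [expMoment, expTilt, lintegral_withDensity_eq_lintegral_mul _
    (measurable_ofReal_exp_mul_inner n l) (measurable_ofReal_exp_mul_inner n m)]
  refine lintegral_congr fun x ↦ ?_
  rw [Pi.mul_apply, ← ENNReal.ofReal_mul (by positivity), ← Real.exp_add, inner_add_left, mul_add]

lemma expTilt_ball_le (μ : Measure V) (n : ℕ) (l y : V) (δ : ℝ) :
    expTilt μ n l (Metric.ball y δ) ≤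
      ENNReal.ofReal (Real.exp (n * (inner ℝ l y + ‖l‖ * δ))) * μ (Metric.ball y δ) := by
  rw [expTilt, withDensity_apply _ measurableSet_ball, ← setLIntegral_const]
  refine setLIntegral_mono measurable_const fun x hx ↦ ?_
  gcongr
  calc inner ℝ l x = inner ℝ l y + inner ℝ l (x - y) := by
        rw [← inner_add_right, add_sub_cancel]
    _ ≤ inner ℝ l y + ‖l‖ * δ := by
        gcongr
        exact (real_inner_le_norm _ _).trans (by gcongr; exact (mem_ball_iff_norm.1 hx).le)

end InnerProductSpace

section EuclideanSpace

variable {d : ℕ} {ν : ℕ → Measure (EuclideanSpace ℝ (Fin d))} {Λ : EuclideanSpace ℝ (Fin d) → EReal}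

lemma IsEConvex.expGrowthSup_le_of_isClosed (hconv : IsEConvex Λ) (hbot : ∀ l, Λ l ≠ ⊥)
    (hint : 0 ∈ interior (effDomain Λ))
    (hlim : ∀ l ∈ interior (effDomain Λ), Tendsto (fun n : ℕ ↦ logMGF (ν n) n l) atTop (𝓝 (Λ l)))
    {F : Set (EuclideanSpace ℝ (Fin d))} (hF : IsClosed F) :
    expGrowthSup (fun n ↦ ν n F) ≤ -(⨅ x ∈ F, fenchel Λ x) := by
  rw [EReal.le_neg]
  refine EReal.ge_of_forall_gt_iff_ge.1 fun c hc ↦ EReal.le_neg.1 ?_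
  refine (expGrowthSup_measure_lt_of_isClosed (L := fun l ↦ (Λ l).toReal)
    (isOpen_interior.mem_nhds hint) (fun l hl ↦ ?_) hF fun x hx ↦
      hconv.exists_mem_interior_lt hbot ⟨0, hint⟩ (hc.trans_le (iInf₂_le x hx))).le
  rw [coe_toReal_of_mem_effDomain hbot (interior_subset hl)]
  exact (hlim l hl).limsup_eq.le

lemma le_fenchel (L : EuclideanSpace ℝ (Fin d) → EReal) (l x : EuclideanSpace ℝ (Fin d)) :
    ((inner ℝ l x : ℝ) : EReal) - L l ≤ fenchel L x :=
  le_iSup (fun l ↦ ((inner ℝ l x : ℝ) : EReal) - L l) l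

lemma IsEConvex.exists_neg_lt_inner_sub_of_exposing (hconv : IsEConvex Λ) (hbot : ∀ l, Λ l ≠ ⊥)
    {l x y : EuclideanSpace ℝ (Fin d)} (hl : l ∈ interior (effDomain Λ))
    (hxy : ((inner ℝ l x : ℝ) : EReal) - fenchel Λ x < ((inner ℝ l y : ℝ) : EReal) - fenchel Λ y) :
    ∃ m, l + m ∈ interior (effDomain Λ) ∧
      -(Λ l).toReal < inner ℝ m x - (Λ (l + m)).toReal := by
  have hreal := coe_toReal_of_mem_effDomain hbot (interior_subset hl)
  have hlt : ((inner ℝ l x : ℝ) : EReal) - fenchel Λ x < (Λ l).toReal := by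
    refine hxy.trans_le ?_
    rw [EReal.sub_le_iff_le_add (by simp) (by simp), add_comm]
    exact (EReal.sub_le_iff_le_add (by simp) (by simp)).1 (hreal ▸ le_fenchel Λ l y)
  rw [EReal.sub_lt_iff (by simp) (by simp), add_comm, ← EReal.sub_lt_iff (by simp) (by simp)] at hlt
  obtain ⟨m, hm, hmx⟩ := hconv.exists_mem_interior_lt hbot ⟨l, hl⟩
    (c := inner ℝ l x - (Λ l).toReal) (by exact_mod_cast hlt)
  refine ⟨m - l, by rwa [add_sub_cancel], ?_⟩
  rw [inner_sub_left, add_sub_cancel]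
  linarith

lemma IsEConvex.le_expGrowthInf_expTilt_ball (hconv : IsEConvex Λ) (hbot : ∀ l, Λ l ≠ ⊥)
    (hlim : ∀ l ∈ interior (effDomain Λ), Tendsto (fun n : ℕ ↦ logMGF (ν n) n l) atTop (𝓝 (Λ l)))
    {l y : EuclideanSpace ℝ (Fin d)} (hl : l ∈ interior (effDomain Λ))
    (hexp : ∀ x, x ≠ y →
      ((inner ℝ l x : ℝ) : EReal) - fenchel Λ x < ((inner ℝ l y : ℝ) : EReal) - fenchel Λ y)
    {δ : ℝ} (hδ : 0 < δ) :
    Λ l ≤ expGrowthInf (fun n ↦ expTilt (ν n) n l (Metric.ball y δ)) := by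
  have hreal : ∀ m ∈ interior (effDomain Λ), ((Λ m).toReal : EReal) = Λ m := fun m hm ↦
    coe_toReal_of_mem_effDomain hbot (interior_subset hm)
  have hfar : expGrowthSup (fun n ↦ expTilt (ν n) n l (Metric.ball y δ)ᶜ) < Λ l := by
    rw [← hreal l hl, ← neg_neg (Λ l).toReal]
    refine expGrowthSup_measure_lt_of_isClosed (U := {m | l + m ∈ interior (effDomain Λ)})
      (L := fun m ↦ (Λ (l + m)).toReal) ?_ (fun m hm ↦ ?_) Metric.isOpen_ball.isClosed_compl
      fun x hx ↦ hconv.exists_neg_lt_inner_sub_of_exposing hbot hl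
        (hexp x fun h ↦ hx (h ▸ Metric.mem_ball_self hδ))
    · exact (isOpen_interior.preimage (continuous_const_add l)).mem_nhds (by simpa using hl)
    · simp only [expMoment_expTilt]
      rw [hreal _ hm]
      exact (hlim _ hm).limsup_eq.le
  have hsplit : Λ l ≤ expGrowthInf (fun n ↦ expTilt (ν n) n l (Metric.ball y δ)) ⊔
      expGrowthSup (fun n ↦ expTilt (ν n) n l (Metric.ball y δ)ᶜ) := by
    refine (hlim l hl).liminf_eq.ge.trans (le_trans ?_ (expGrowthInf_add_le _ _))
    refine expGrowthInf_monotone fun n ↦ le_of_eq ?_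
    rw [Pi.add_apply, measure_add_measure_compl measurableSet_ball, ← expMoment_zero _ n,
      expMoment_expTilt, add_zero]
    rfl
  exact (le_sup_iff.1 hsplit).resolve_right hfar.not_ge

lemma IsEConvex.le_expGrowthInf_of_isOpen (hconv : IsEConvex Λ) (hbot : ∀ l, Λ l ≠ ⊥)
    (hlim : ∀ l ∈ interior (effDomain Λ), Tendsto (fun n : ℕ ↦ logMGF (ν n) n l) atTop (𝓝 (Λ l)))
    {G : Set (EuclideanSpace ℝ (Fin d))} (hG : IsOpen G) :
    -(⨅ x ∈ G ∩ exposedPoints Λ, fenchel Λ x) ≤ expGrowthInf (fun n ↦ ν n G) := by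
  rw [EReal.neg_le]
  refine le_iInf₂ fun y ⟨hyG, l, hl, hexp⟩ ↦ EReal.neg_le.1 ?_
  obtain ⟨δ₀, hδ₀, hball⟩ := Metric.isOpen_iff.1 hG y hyG
  have hreal := coe_toReal_of_mem_effDomain hbot (interior_subset hl)
  have hshift : ∀ δ ∈ Set.Ioo 0 δ₀, (((Λ l).toReal - (inner ℝ l y + ‖l‖ * δ) : ℝ) : EReal) ≤
      expGrowthInf (fun n ↦ ν n G) := fun δ hδ ↦ by
    rw [EReal.coe_sub, hreal]
    refine EReal.sub_le_of_le_add' ?_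
    calc Λ l ≤ expGrowthInf (fun n ↦ expTilt (ν n) n l (Metric.ball y δ)) :=
          hconv.le_expGrowthInf_expTilt_ball hbot hlim hl hexp hδ.1
      _ ≤ expGrowthInf (fun n : ℕ ↦
            ENNReal.ofReal (Real.exp (n * (inner ℝ l y + ‖l‖ * δ))) * ν n G) := by
          refine expGrowthInf_monotone fun n ↦ (expTilt_ball_le _ n l y δ).trans ?_
          gcongr
          exact (Metric.ball_subset_ball hδ.2.le).trans hball
      _ ≤ _ := expGrowthInf_exp_mul_le _ _
  have hlimit : (((Λ l).toReal - inner ℝ l y : ℝ) : EReal) ≤ expGrowthInf (fun n ↦ ν n G) := by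
    refine le_of_tendsto ((continuous_coe_real_ereal.tendsto _).comp ?_)
      (Filter.mem_of_superset (Ioo_mem_nhdsGT hδ₀) hshift)
    exact (Continuous.tendsto' (by fun_prop) 0 _ (by simp)).mono_left nhdsWithin_le_nhds
  refine le_trans ?_ hlimit
  rw [EReal.neg_le, ← EReal.coe_neg, neg_sub, EReal.coe_sub, hreal]
  exact le_fenchel Λ l y

end EuclideanSpace

end GartnerEllis

/-! ### Subgradients -/

section Subgradient

variable {V : Type*} [NormedAddCommGroup V] [InnerProductSpace ℝ V] {D : Set V} {f : V → ℝ}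

lemma le_add_fderiv_of_forall_add_le (hf : ConvexOn ℝ D f) {q : V → ℝ} {q' : V →L[ℝ] ℝ} {l m : V}
    (hl : l ∈ D) (hm : m ∈ D) (hq : HasFDerivAt q q' l)
    (hmin : ∀ z ∈ D, f l + q l ≤ f z + q z) : f l ≤ f m + q' (m - l) := by
  rw [← AffineMap.lineMap_apply_zero (k := ℝ) l m] at hq
  have hslope := (hq.comp_hasDerivAt 0 AffineMap.hasDerivAt_lineMap).tendsto_slope_zero_right
  refine sub_le_iff_le_add'.1 (ge_of_tendsto hslope ?_)
  filter_upwards [Ioo_mem_nhdsGT (zero_lt_one' ℝ)] with t ht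
  have hconv := hf.2 hl hm (sub_nonneg.2 ht.2.le) ht.1.le (by ring)
  have hmem := hf.1 hl hm (sub_nonneg.2 ht.2.le) ht.1.le (by ring)
  rw [← AffineMap.lineMap_apply_module] at hconv hmem
  have := hmin _ hmem
  simp only [Function.comp_apply, zero_add, AffineMap.lineMap_apply_zero, smul_eq_mul] at hconv ⊢
  rw [le_inv_mul_iff₀ ht.1]
  linarith

variable [CompleteSpace V]

lemma add_inner_gradient_le (hf : ConvexOn ℝ D f) {p x : V} (hp : p ∈ D) (hx : x ∈ D)
    (hd : DifferentiableAt ℝ f p) : f p + inner ℝ (gradient f p) (x - p) ≤ f x := by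
  have hfd : HasFDerivAt f (InnerProductSpace.toDual ℝ V (gradient f p))
      (AffineMap.lineMap p x (0 : ℝ)) := by
    simpa using hd.hasGradientAt.hasFDerivAt
  have hslope := (hf.comp_affineMap (AffineMap.lineMap p x)).le_slope_of_hasDerivAt
    (x := (0 : ℝ)) (y := 1) (by simpa using hp) (by simpa using hx) one_pos
    (hfd.comp_hasDerivAt 0 AffineMap.hasDerivAt_lineMap)
  simp only [slope_def_field, Function.comp_apply, AffineMap.lineMap_apply_zero,
    AffineMap.lineMap_apply_one, sub_zero, div_one, InnerProductSpace.toDual_apply_apply] at hslope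
  linarith

lemma gradient_eq_of_eventually_add_inner_le {l w : V} (hd : DifferentiableAt ℝ f l)
    (h : ∀ᶠ m in 𝓝 l, f l + inner ℝ w (m - l) ≤ f m) : gradient f l = w := by
  have hmin : IsLocalMin (fun m ↦ f m - inner ℝ w m) l := by
    filter_upwards [h] with m hm
    rw [inner_sub_right] at hm
    linarith
  exact (InnerProductSpace.toDual ℝ V).injective <| sub_eq_zero.1 <| hmin.hasFDerivAt_eq_zero <|
    hd.hasGradientAt.hasFDerivAt.sub (InnerProductSpace.toDual ℝ V w).hasFDerivAt

lemma radius_mul_norm_gradient_le (hf : ConvexOn ℝ D f) {a p : V} {r M : ℝ} (hr : 0 ≤ r)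
    (hball : Metric.closedBall a r ⊆ D) (hM : ∀ x ∈ Metric.closedBall a r, f x ≤ M) (hp : p ∈ D)
    (hd : DifferentiableAt ℝ f p) :
    r * ‖gradient f p‖ ≤ M - f p + inner ℝ (gradient f p) (p - a) := by
  set v := gradient f p
  have hu : ‖‖v‖⁻¹ • v‖ ≤ 1 := by
    rw [norm_smul, norm_inv, norm_norm]
    exact inv_mul_le_one
  have huv : inner ℝ v (‖v‖⁻¹ • v) = ‖v‖ := by
    rw [real_inner_smul_right, real_inner_self_eq_norm_mul_norm, ← mul_assoc, inv_mul_mul_self]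
  have hx : a + r • ‖v‖⁻¹ • v ∈ Metric.closedBall a r := by
    rw [mem_closedBall_iff_norm, add_sub_cancel_left, norm_smul, Real.norm_of_nonneg hr]
    exact mul_le_of_le_one_right hr hu
  have hgrad := (add_inner_gradient_le hf hp (hball hx) hd).trans (hM _ hx)
  rw [add_sub_right_comm, inner_add_right, real_inner_smul_right, huv, ← neg_sub p a,
    inner_neg_right] at hgrad
  linarith

lemma norm_gradient_lineMap_le (hf : ConvexOn ℝ D f) {a l w : V} {r M : ℝ} (hr : 0 < r)
    (hball : Metric.closedBall a r ⊆ D) (hM : ∀ x ∈ Metric.closedBall a r, f x ≤ M) (hl : l ∈ D)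
    (hw : ∀ m ∈ D, f l + inner ℝ w (m - l) ≤ f m) {t : ℝ} (ht : t ∈ Set.Ico 0 1)
    (hd : DifferentiableAt ℝ f (AffineMap.lineMap a l t)) :
    ‖gradient f (AffineMap.lineMap a l t)‖ ≤ (M - f l + 2 * (‖w‖ * ‖l - a‖)) / r := by
  set p : V := AffineMap.lineMap a l t
  set v := gradient f p
  have hp : p ∈ D := hf.1.lineMap_mem (hball (Metric.mem_closedBall_self hr.le)) hl ⟨ht.1, ht.2.le⟩
  have hpa : p - a = t • (l - a) := AffineMap.lineMap_vsub_left a l t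
  have hlp : l - p = (1 - t) • (l - a) := AffineMap.right_vsub_lineMap a l t
  have hwp := hw p hp
  rw [← neg_sub l p, inner_neg_right, hlp, real_inner_smul_right] at hwp
  have hmono : inner ℝ v (l - a) ≤ inner ℝ w (l - a) := by
    have hvl := add_inner_gradient_le hf hp hl hd
    rw [hlp, real_inner_smul_right] at hvl
    exact le_of_mul_le_mul_left (by linarith) (sub_pos.2 ht.2)
  have hvp := radius_mul_norm_gradient_le hf hr.le hball hM hp hd
  rw [hpa, real_inner_smul_right] at hvp
  rw [le_div_iff₀ hr, mul_comm]
  nlinarith [real_inner_le_norm w (l - a), norm_nonneg w, norm_nonneg (l - a), ht.1, ht.2]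

lemma mem_interior_of_steep_of_subgradient [FiniteDimensional ℝ V] (hf : ConvexOn ℝ D f)
    (hne : (interior D).Nonempty) (hd : ∀ l ∈ interior D, DifferentiableAt ℝ f l)
    (hsteep : ∀ (u : ℕ → V) (l : V), (∀ n, u n ∈ interior D) → l ∈ frontier (interior D) →
      Tendsto u atTop (𝓝 l) → Tendsto (fun n ↦ ‖gradient f (u n)‖) atTop atTop)
    {l w : V} (hl : l ∈ D) (hw : ∀ m ∈ D, f l + inner ℝ w (m - l) ≤ f m) : l ∈ interior D := by
  by_contra hli
  obtain ⟨a, ha⟩ := hne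
  obtain ⟨r, hr, hball⟩ := Metric.nhds_basis_closedBall.mem_iff.1 (isOpen_interior.mem_nhds ha)
  obtain ⟨M, hM⟩ := ((isCompact_closedBall a r).image_of_continuousOn
    (hf.continuousOn_interior.mono hball)).bddAbove
  obtain ⟨t, -, ht, htlim⟩ := exists_seq_strictMono_tendsto' (zero_lt_one' ℝ)
  have hu : ∀ n, AffineMap.lineMap a l (t n) ∈ interior D := fun n ↦ by
    rw [AffineMap.lineMap_apply_module]
    exact hf.1.combo_interior_self_mem_interior ha hl (sub_pos.2 (ht n).2) (ht n).1.le (by ring)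
  have hulim : Tendsto (fun n ↦ AffineMap.lineMap a l (t n)) atTop (𝓝 l) := by
    have := (AffineMap.lineMap_continuous (p := a) (q := l)).tendsto (1 : ℝ)
    rw [AffineMap.lineMap_apply_one] at this
    exact this.comp htlim
  have hfrontier : l ∈ frontier (interior D) :=
    ⟨mem_closure_of_tendsto hulim (Eventually.of_forall hu), by rwa [interior_interior]⟩
  obtain ⟨n, hn⟩ := ((hsteep _ l hu hfrontier hulim).eventually_gt_atTop
    ((M - f l + 2 * (‖w‖ * ‖l - a‖)) / r)).exists
  exact hn.not_ge (norm_gradient_lineMap_le hf hr (hball.trans interior_subset)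
    (fun x hx ↦ hM (Set.mem_image_of_mem f hx)) hl hw ⟨(ht n).1.le, (ht n).2⟩ (hd _ (hu n)))

end Subgradient

/-! ### Convex duality and essential smoothness -/

section Duality

variable {d : ℕ} {Λ : EuclideanSpace ℝ (Fin d) → EReal}

lemma fenchel_nonneg (h0 : Λ 0 ≤ 0) (x : EuclideanSpace ℝ (Fin d)) : 0 ≤ fenchel Λ x :=
  le_trans (by simpa using h0) (le_fenchel Λ 0 x)

lemma coe_inner_sub_toReal_le_fenchel (hbot : ∀ l, Λ l ≠ ⊥) {l : EuclideanSpace ℝ (Fin d)}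
    (hl : l ∈ effDomain Λ) (x : EuclideanSpace ℝ (Fin d)) :
    ((inner ℝ l x - (Λ l).toReal : ℝ) : EReal) ≤ fenchel Λ x := by
  rw [EReal.coe_sub, coe_toReal_of_mem_effDomain hbot hl]
  exact le_fenchel Λ l x

lemma fenchel_le_of_forall_mem_effDomain (hbot : ∀ l, Λ l ≠ ⊥) {x : EuclideanSpace ℝ (Fin d)}
    {c : ℝ} (h : ∀ l ∈ effDomain Λ, inner ℝ l x - (Λ l).toReal ≤ c) : fenchel Λ x ≤ c := by
  refine iSup_le fun l ↦ ?_
  by_cases hl : l ∈ effDomain Λ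
  · rw [← coe_toReal_of_mem_effDomain hbot hl, ← EReal.coe_sub]
    exact_mod_cast h l hl
  · rw [eq_top_of_notMem_effDomain hl, EReal.sub_top]
    exact bot_le

lemma lowerSemicontinuous_fenchel (hbot : ∀ l, Λ l ≠ ⊥) : LowerSemicontinuous (fenchel Λ) := by
  refine lowerSemicontinuous_iSup fun l ↦ Continuous.lowerSemicontinuous ?_
  by_cases hl : l ∈ effDomain Λ
  · rw [← coe_toReal_of_mem_effDomain hbot hl]
    simp only [← EReal.coe_sub]
    exact continuous_coe_real_ereal.comp (by fun_prop)
  · simp only [eq_top_of_notMem_effDomain hl, EReal.sub_top]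
    exact continuous_const

lemma isGoodRateFunction_fenchel (hbot : ∀ l, Λ l ≠ ⊥) (h0 : Λ 0 ≤ 0)
    (hint : 0 ∈ interior (effDomain Λ)) : IsGoodRateFunction (fenchel Λ) where
  nonneg := fenchel_nonneg h0
  lowerSemicontinuous := lowerSemicontinuous_fenchel hbot
  isCompact_level a _ := by
    refine Metric.isCompact_of_isClosed_isBounded
      ((lowerSemicontinuous_fenchel hbot).isClosed_preimage (a : EReal)) ?_
    obtain ⟨T, hT, hTb⟩ := exists_finset_isBounded_polar (mem_interior_iff_mem_nhds.1 hint)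
      (fun l ↦ (Λ l).toReal + a)
    refine hTb.subset fun x hx l hl ↦ sub_le_iff_le_add'.1 ?_
    exact_mod_cast (coe_inner_sub_toReal_le_fenchel hbot (hT hl) x).trans hx

lemma fenchel_eq_of_subgradient (hbot : ∀ l, Λ l ≠ ⊥) {l z : EuclideanSpace ℝ (Fin d)}
    (hl : l ∈ effDomain Λ)
    (hz : ∀ m ∈ effDomain Λ, (Λ l).toReal + inner ℝ z (m - l) ≤ (Λ m).toReal) :
    fenchel Λ z = ((inner ℝ l z - (Λ l).toReal : ℝ) : EReal) := by
  refine le_antisymm (fenchel_le_of_forall_mem_effDomain hbot fun m hm ↦ ?_)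
    (coe_inner_sub_toReal_le_fenchel hbot hl z)
  have := hz m hm
  rw [real_inner_comm, inner_sub_left] at this
  linarith

lemma mem_exposedPoints_of_subgradient (hbot : ∀ l, Λ l ≠ ⊥) {l z : EuclideanSpace ℝ (Fin d)}
    (hl : l ∈ interior (effDomain Λ)) (hd : DifferentiableAt ℝ (fun m ↦ (Λ m).toReal) l)
    (hz : ∀ m ∈ effDomain Λ, (Λ l).toReal + inner ℝ z (m - l) ≤ (Λ m).toReal) :
    z ∈ exposedPoints Λ := by
  have hnhds := mem_interior_iff_mem_nhds.1 hl
  refine ⟨l, hl, fun x hx ↦ ?_⟩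
  have hlt : ((inner ℝ l x - (Λ l).toReal : ℝ) : EReal) < fenchel Λ x := by
    by_contra! hle
    refine hx (Eq.trans (Eq.symm ?_) (gradient_eq_of_eventually_add_inner_le hd
      (Filter.mem_of_superset hnhds hz)))
    refine gradient_eq_of_eventually_add_inner_le hd (Filter.mem_of_superset hnhds fun m hm ↦ ?_)
    have : inner ℝ m x - (Λ m).toReal ≤ inner ℝ l x - (Λ l).toReal := by
      exact_mod_cast (coe_inner_sub_toReal_le_fenchel hbot hm x).trans hle
    rw [Set.mem_ofPred_eq, real_inner_comm, inner_sub_left]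
    linarith
  rw [fenchel_eq_of_subgradient hbot (interior_subset hl) hz, ← EReal.coe_sub, sub_sub_cancel,
    EReal.sub_lt_iff (by simp) (by simp), add_comm, ← EReal.sub_lt_iff (by simp) (by simp)]
  exact_mod_cast hlt

lemma isBounded_add_norm_sq_le {V : Type*} [NormedAddCommGroup V] [InnerProductSpace ℝ V]
    {D : Set V} {f : V → ℝ} {y : V} {s ε A : ℝ} (hε : 0 < ε)
    (hs : ∀ l ∈ D, inner ℝ y l - f l ≤ s) :
    Bornology.IsBounded {l ∈ D | f l + (ε / 2 * ‖l‖ ^ 2 - inner ℝ y l) ≤ A} := by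
  refine isBounded_iff_forall_norm_le.2 ⟨1 + (A + s) / (ε / 2), fun l ⟨hlD, hl⟩ ↦ ?_⟩
  have hsq : ‖l‖ ^ 2 ≤ (A + s) / (ε / 2) := by
    rw [le_div_iff₀ (by positivity)]
    linarith [hs l hlD]
  nlinarith [sq_nonneg (‖l‖ - 1)]

lemma exists_forall_add_norm_sq_le (hbot : ∀ l, Λ l ≠ ⊥) (hne : (effDomain Λ).Nonempty)
    (hlsc : LowerSemicontinuous Λ) {y : EuclideanSpace ℝ (Fin d)} (hy : fenchel Λ y < ⊤) {ε : ℝ}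
    (hε : 0 < ε) :
    ∃ l ∈ effDomain Λ, ∀ m ∈ effDomain Λ, (Λ l).toReal + (ε / 2 * ‖l‖ ^ 2 - inner ℝ y l) ≤
      (Λ m).toReal + (ε / 2 * ‖m‖ ^ 2 - inner ℝ y m) := by
  obtain ⟨s, hs, -⟩ := EReal.lt_iff_exists_real_btwn.1 hy
  obtain ⟨a, ha⟩ := hne
  set φ : EuclideanSpace ℝ (Fin d) → EReal := fun l ↦
    Λ l + ((ε / 2 * ‖l‖ ^ 2 - inner ℝ y l : ℝ) : EReal)
  have hφ : ∀ l ∈ effDomain Λ,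
      φ l = (((Λ l).toReal + (ε / 2 * ‖l‖ ^ 2 - inner ℝ y l) : ℝ) : EReal) := fun l hl ↦ by
    rw [EReal.coe_add, coe_toReal_of_mem_effDomain hbot hl]
  have hφlsc : LowerSemicontinuous φ :=
    hlsc.add' (continuous_coe_real_ereal.comp (by fun_prop)).lowerSemicontinuous fun l ↦
      EReal.continuousAt_add (Or.inr (EReal.coe_ne_bot _)) (Or.inl (hbot l))
  have hdom : ∀ l, φ l ≤ φ a → l ∈ effDomain Λ := fun l hl ↦ by
    by_contra h
    rw [hφ a ha] at hl
    simp only [φ, eq_top_of_notMem_effDomain h, EReal.top_add_coe] at hl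
    exact (EReal.coe_lt_top _).not_ge hl
  have hbdd : Bornology.IsBounded {l | φ l ≤ φ a} := by
    refine (isBounded_add_norm_sq_le (D := effDomain Λ) (f := fun l ↦ (Λ l).toReal) (y := y)
      (s := s) (A := (Λ a).toReal + (ε / 2 * ‖a‖ ^ 2 - inner ℝ y a)) hε fun l hl ↦ ?_).subset
      fun l hl ↦ ⟨hdom l hl, ?_⟩
    · rw [real_inner_comm]
      exact_mod_cast (coe_inner_sub_toReal_le_fenchel hbot hl y).trans hs.le
    · rwa [Set.mem_ofPred_eq, hφ l (hdom l hl), hφ a ha, EReal.coe_le_coe_iff] at hl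
  obtain ⟨l, hl, hmin⟩ := (hφlsc.lowerSemicontinuousOn _).exists_isMinOn ⟨a, le_refl (φ a)⟩
    (Metric.isCompact_of_isClosed_isBounded (hφlsc.isClosed_preimage (φ a)) hbdd)
  refine ⟨l, hdom l hl, fun m hm ↦ ?_⟩
  rw [← EReal.coe_le_coe_iff, ← hφ l (hdom l hl), ← hφ m hm]
  rcases le_total (φ m) (φ a) with h | h
  · exact hmin h
  · exact le_trans hl h

lemma exists_mem_exposedPoints_norm_sub_sq_le (hconv : IsEConvex Λ) (hbot : ∀ l, Λ l ≠ ⊥)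
    (h0 : Λ 0 ≤ 0) (hsm : EssentiallySmooth Λ) (hlsc : LowerSemicontinuous Λ)
    {y : EuclideanSpace ℝ (Fin d)} (hy : fenchel Λ y < ⊤) {ε : ℝ} (hε : 0 < ε) :
    ∃ z ∈ exposedPoints Λ, fenchel Λ z ≤ fenchel Λ y ∧
      ‖z - y‖ ^ 2 ≤ ε * (fenchel Λ y).toReal := by
  have hfconv := hconv.convexOn_toReal hbot
  obtain ⟨l, hl, hmin⟩ :=
    exists_forall_add_norm_sq_le hbot (hsm.nonempty.mono interior_subset) hlsc hy hε
  have hz : ∀ m ∈ effDomain Λ, (Λ l).toReal + inner ℝ (y - ε • l) (m - l) ≤ (Λ m).toReal := by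
    intro m hm
    have hq := ((hasStrictFDerivAt_norm_sq l).hasFDerivAt.const_mul (ε / 2)).sub
      (InnerProductSpace.toDual ℝ _ y).hasFDerivAt
    have := le_add_fderiv_of_forall_add_le hfconv hl hm hq hmin
    simp only [_root_.sub_apply, _root_.smul_apply, InnerProductSpace.toDual_apply_apply,
      innerSL_apply_apply, smul_eq_mul, nsmul_eq_mul] at this
    push_cast at this
    rw [inner_sub_left, real_inner_smul_left]
    linarith
  have hli := mem_interior_of_steep_of_subgradient hfconv hsm.nonempty hsm.differentiable hsm.steep
    hl hz
  have hzeq := fenchel_eq_of_subgradient hbot hl hz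
  set z := y - ε • l with hz_def
  have hlz : inner ℝ l z = inner ℝ l y - ε * ‖l‖ ^ 2 := by
    rw [hz_def, inner_sub_right, real_inner_smul_right, real_inner_self_eq_norm_sq]
  have hyl := coe_inner_sub_toReal_le_fenchel hbot hl y
  refine ⟨z, mem_exposedPoints_of_subgradient hbot hli (hsm.differentiable l hli) hz, ?_, ?_⟩
  · refine le_trans ?_ hyl
    rw [hzeq, EReal.coe_le_coe_iff, hlz]
    linarith [show 0 ≤ ε * ‖l‖ ^ 2 by positivity]
  · have hz0 : 0 ≤ inner ℝ l z - (Λ l).toReal := by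
      exact_mod_cast (fenchel_nonneg h0 z).trans_eq hzeq
    rw [← EReal.coe_toReal hy.ne (ne_bot_of_le_ne_bot (EReal.coe_ne_bot _) hyl),
      EReal.coe_le_coe_iff] at hyl
    have hnorm : ‖z - y‖ ^ 2 = ε * (ε * ‖l‖ ^ 2) := by
      rw [hz_def, sub_sub_cancel_left, norm_neg, norm_smul, Real.norm_of_nonneg hε.le]
      ring
    rw [hnorm]
    gcongr
    linarith

lemma iInf_inter_exposedPoints_le (hconv : IsEConvex Λ) (hbot : ∀ l, Λ l ≠ ⊥) (h0 : Λ 0 ≤ 0)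
    (hsm : EssentiallySmooth Λ) (hlsc : LowerSemicontinuous Λ)
    {G : Set (EuclideanSpace ℝ (Fin d))} (hG : IsOpen G) :
    ⨅ x ∈ G ∩ exposedPoints Λ, fenchel Λ x ≤ ⨅ x ∈ G, fenchel Λ x := by
  refine le_iInf₂ fun y hy ↦ ?_
  rcases eq_top_or_lt_top (fenchel Λ y) with htop | htop
  · exact htop ▸ le_top
  obtain ⟨δ, hδ, hball⟩ := Metric.isOpen_iff.1 hG y hy
  set s := (fenchel Λ y).toReal
  have hs0 : 0 ≤ s := EReal.toReal_nonneg (fenchel_nonneg h0 y)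
  obtain ⟨z, hz, hzy, hdist⟩ := exists_mem_exposedPoints_norm_sub_sq_le hconv hbot h0 hsm hlsc htop
    (ε := δ ^ 2 / (s + 1)) (by positivity)
  refine (iInf₂_le z ⟨hball ?_, hz⟩).trans hzy
  rw [mem_ball_iff_norm]
  refine lt_of_pow_lt_pow_left₀ 2 hδ.le (hdist.trans_lt ?_)
  rw [div_mul_eq_mul_div, div_lt_iff₀ (by positivity)]
  nlinarith [pow_pos hδ 2]

lemma satisfiesLDP_fenchel {ν : ℕ → Measure (EuclideanSpace ℝ (Fin d))} (hconv : IsEConvex Λ)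
    (hbot : ∀ l, Λ l ≠ ⊥) (h0 : Λ 0 ≤ 0) (hint : 0 ∈ interior (effDomain Λ))
    (hlim : ∀ l ∈ interior (effDomain Λ), Tendsto (fun n : ℕ ↦ logMGF (ν n) n l) atTop (𝓝 (Λ l)))
    (hsm : EssentiallySmooth Λ) (hlsc : LowerSemicontinuous Λ) : SatisfiesLDP ν (fenchel Λ) := by
  refine fun Γ _ ↦ ⟨?_, ?_⟩
  · calc -(⨅ x ∈ interior Γ, fenchel Λ x)
        ≤ -(⨅ x ∈ interior Γ ∩ exposedPoints Λ, fenchel Λ x) :=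
          EReal.neg_le_neg_iff.2
            (iInf_inter_exposedPoints_le hconv hbot h0 hsm hlsc isOpen_interior)
      _ ≤ ExpGrowth.expGrowthInf (fun n ↦ ν n (interior Γ)) :=
          hconv.le_expGrowthInf_of_isOpen hbot hlim isOpen_interior
      _ ≤ ExpGrowth.expGrowthInf (fun n ↦ ν n Γ) :=
          ExpGrowth.expGrowthInf_monotone fun n ↦ measure_mono interior_subset
  · calc ExpGrowth.expGrowthSup (fun n ↦ ν n Γ)
        ≤ ExpGrowth.expGrowthSup (fun n ↦ ν n (closure Γ)) :=
          ExpGrowth.expGrowthSup_monotone fun n ↦ measure_mono subset_closure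
      _ ≤ -(⨅ x ∈ closure Γ, fenchel Λ x) :=
          hconv.expGrowthSup_le_of_isClosed hbot hint hlim isClosed_closure

end Duality

/-! ### Strong mixing and covariances -/

section Mixing

variable {Ω E : Type*} {𝒰 𝒰' 𝒱 𝒱' : MeasurableSpace Ω} [MeasurableSpace Ω]
  [mE : MeasurableSpace E] {P : Measure Ω}

lemma alphaCoeff_le {a : ℝ} (h : ∀ U V, MeasurableSet[𝒰] U → MeasurableSet[𝒱] V →
    |P.real U * P.real V - P.real (U ∩ V)| ≤ a) : alphaCoeff P 𝒰 𝒱 ≤ a := by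
  refine csSup_le ⟨_, ∅, ∅, @MeasurableSet.empty _ 𝒰, @MeasurableSet.empty _ 𝒱, rfl⟩ ?_
  rintro r ⟨U, V, hU, hV, rfl⟩
  exact h U V hU hV

variable [IsProbabilityMeasure P]

lemma abs_measureReal_mul_sub_measureReal_inter_le_one (U V : Set Ω) :
    |P.real U * P.real V - P.real (U ∩ V)| ≤ 1 :=
  abs_sub_le_of_le_of_le (by positivity)
    (mul_le_one₀ measureReal_le_one measureReal_nonneg measureReal_le_one) measureReal_nonneg
    measureReal_le_one |>.trans_eq (sub_zero 1)

lemma le_alphaCoeff {U V : Set Ω} (hU : MeasurableSet[𝒰] U) (hV : MeasurableSet[𝒱] V) :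
    |P.real U * P.real V - P.real (U ∩ V)| ≤ alphaCoeff P 𝒰 𝒱 :=
  le_csSup ⟨1, by
    rintro r ⟨U, V, -, -, rfl⟩
    exact abs_measureReal_mul_sub_measureReal_inter_le_one U V⟩ ⟨U, V, hU, hV, rfl⟩

lemma alphaCoeff_le_one : alphaCoeff P 𝒰 𝒱 ≤ 1 :=
  alphaCoeff_le fun U V _ _ ↦ abs_measureReal_mul_sub_measureReal_inter_le_one U V

lemma alphaCoeff_nonneg : 0 ≤ alphaCoeff P 𝒰 𝒱 :=
  (abs_nonneg _).trans (le_alphaCoeff (@MeasurableSet.empty _ 𝒰) (@MeasurableSet.empty _ 𝒱))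

lemma alphaCoeff_mono (hU : 𝒰 ≤ 𝒰') (hV : 𝒱 ≤ 𝒱') :
    alphaCoeff P 𝒰 𝒱 ≤ alphaCoeff P 𝒰' 𝒱' :=
  alphaCoeff_le fun U V h𝒰 h𝒱 ↦ le_alphaCoeff (hU U h𝒰) (hV V h𝒱)

lemma alphaCoeff_le_mixingCoeff (X : ℕ → Ω → E) {m : ℕ} (hm : m ≠ 0) (i : ℕ) :
    alphaCoeff P (⨆ k ∈ Set.Iic i, mE.comap (X k)) (⨆ j ∈ Set.Ici (i + m), mE.comap (X j)) ≤
      mixingCoeff P X m := by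
  rw [mixingCoeff, if_neg hm]
  refine le_ciSup (f := fun i : ℕ ↦ alphaCoeff P (⨆ k ∈ Set.Iic i, mE.comap (X k))
    (⨆ j ∈ Set.Ici (i + m), mE.comap (X j))) ⟨1, ?_⟩ i
  rintro _ ⟨i, rfl⟩
  exact alphaCoeff_le_one

lemma mixingCoeff_nonneg (X : ℕ → Ω → E) (m : ℕ) : 0 ≤ mixingCoeff P X m := by
  rcases eq_or_ne m 0 with rfl | hm
  · simp [mixingCoeff]
  · exact alphaCoeff_nonneg.trans (alphaCoeff_le_mixingCoeff X hm 0)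

lemma mixingCoeff_le_one (X : ℕ → Ω → E) (m : ℕ) : mixingCoeff P X m ≤ 1 := by
  rw [mixingCoeff]
  split_ifs
  · norm_num
  · exact ciSup_le fun i ↦ alphaCoeff_le_one

lemma mixingCoeff_anti (X : ℕ → Ω → E) {m m' : ℕ} (hm : m ≠ 0) (hmm : m ≤ m') :
    mixingCoeff P X m' ≤ mixingCoeff P X m := by
  rw [mixingCoeff, if_neg (by omega)]
  refine ciSup_le fun i ↦ le_trans (alphaCoeff_mono le_rfl ?_) (alphaCoeff_le_mixingCoeff X hm i)
  refine iSup₂_mono' fun j hj ↦ ⟨j, ?_, le_rfl⟩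
  simp only [Set.mem_Ici] at hj ⊢
  omega

-- The factor `1/2` covers the index `0`: there the coefficient is `1/2`, elsewhere at most `1`.
lemma natCast_le_mixingInv (X : ℕ → Ω → E) {m : ℕ} {u : ℝ} (hu : u < mixingCoeff P X m / 2) :
    (m : ℝ≥0∞) ≤ mixingInv P X u := by
  have hle := mixingCoeff_le_one (P := P) X m
  have hnonneg := mixingCoeff_nonneg (P := P) X m
  refine le_iInf₂ fun m' hm' ↦ ?_
  by_contra! hlt
  have hlt' : m' < m := by exact_mod_cast hlt
  rcases eq_or_ne m' 0 with rfl | h0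
  · simp only [mixingCoeff, if_true] at hm'
    linarith
  · linarith [mixingCoeff_anti (P := P) X h0 hlt'.le]

lemma natCast_rpow_mul_mixingCoeff_le (X : ℕ → Ω → E) {h : ℝ} (hh : 0 ≤ h) (m : ℕ) :
    (m : ℝ≥0∞) ^ h * ENNReal.ofReal (mixingCoeff P X m / 2) ≤
      ∫⁻ u in Set.Icc (0 : ℝ) 1, mixingInv P X u ^ h := by
  set a := mixingCoeff P X m
  have ha : a ≤ 1 := mixingCoeff_le_one X m
  calc (m : ℝ≥0∞) ^ h * ENNReal.ofReal (a / 2)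
      = ∫⁻ _ in Set.Ico (0 : ℝ) (a / 2), (m : ℝ≥0∞) ^ h := by
        rw [setLIntegral_const, Real.volume_Ico, sub_zero]
    _ ≤ ∫⁻ u in Set.Ico (0 : ℝ) (a / 2), mixingInv P X u ^ h :=
        setLIntegral_mono' measurableSet_Ico fun u hu ↦
          ENNReal.rpow_le_rpow (natCast_le_mixingInv X hu.2) hh
    _ ≤ ∫⁻ u in Set.Icc (0 : ℝ) 1, mixingInv P X u ^ h :=
        lintegral_mono_set fun u hu ↦ ⟨hu.1, by linarith [hu.2]⟩

lemma exists_mixingCoeff_le_mul_rpow (X : ℕ → Ω → E) {h : ℝ} (hh : 0 ≤ h)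
    (hmix : ∫⁻ u in Set.Icc (0 : ℝ) 1, mixingInv P X u ^ h < ⊤) :
    ∃ C : ℝ, 0 ≤ C ∧ ∀ m : ℕ, m ≠ 0 → mixingCoeff P X m ≤ C * (m : ℝ) ^ (-h) := by
  set I := ∫⁻ u in Set.Icc (0 : ℝ) 1, mixingInv P X u ^ h
  refine ⟨2 * I.toReal, by positivity, fun m hm ↦ ?_⟩
  have ha := mixingCoeff_nonneg (P := P) X m
  have hI := ENNReal.toReal_mono hmix.ne (natCast_rpow_mul_mixingCoeff_le (P := P) X hh m)
  rw [ENNReal.toReal_mul, ENNReal.toReal_ofReal (by positivity), ← ENNReal.toReal_rpow,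
    ENNReal.toReal_natCast] at hI
  rw [Real.rpow_neg (by positivity), ← div_eq_mul_inv, le_div_iff₀ (by positivity)]
  linarith

end Mixing

section Covariance

variable {Ω : Type*} {𝒰 𝒱 : MeasurableSpace Ω} [mΩ : MeasurableSpace Ω] {P : Measure Ω}

lemma lintegral_le_of_measure_superlevel_le {ν : Measure Ω} {g : Ω → ℝ} (hg : Measurable g)
    (hg0 : ∀ ω, 0 ≤ g ω) {M : ℝ} (hgM : ∀ ω, g ω ≤ M) {c b : ℝ≥0∞}
    (h : ∀ t : ℝ, 0 < t → ν {ω | t < g ω} ≤ c * P {ω | t < g ω} + b) :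
    ∫⁻ ω, ENNReal.ofReal (g ω) ∂ν ≤
      c * ∫⁻ ω, ENNReal.ofReal (g ω) ∂P + b * ENNReal.ofReal M := by
  rw [lintegral_eq_lintegral_meas_lt ν (Eventually.of_forall hg0) hg.aemeasurable,
    lintegral_eq_lintegral_meas_lt P (Eventually.of_forall hg0) hg.aemeasurable]
  have hanti : Antitone fun t : ℝ ↦ P {ω | t < g ω} := fun s t hst ↦
    measure_mono fun ω (hω : t < g ω) ↦ hst.trans_lt hω
  calc ∫⁻ t in Set.Ioi (0 : ℝ), ν {ω | t < g ω}
      ≤ ∫⁻ t in Set.Ioi (0 : ℝ), (c * P {ω | t < g ω} +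
          (Set.Iio M).indicator (fun _ ↦ b) t) := by
        refine setLIntegral_mono' measurableSet_Ioi fun t ht ↦ ?_
        by_cases htM : t < M
        · rw [Set.indicator_of_mem (Set.mem_Iio.2 htM)]
          exact h t ht
        · have : {ω | t < g ω} = ∅ :=
            Set.eq_empty_of_forall_notMem fun ω hω ↦ htM (lt_of_lt_of_le hω (hgM ω))
          simp [this]
    _ = c * (∫⁻ t in Set.Ioi (0 : ℝ), P {ω | t < g ω}) + b * ENNReal.ofReal M := by
        rw [lintegral_add_left (hanti.measurable.const_mul c),
          lintegral_const_mul c hanti.measurable,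
          lintegral_indicator measurableSet_Iio, setLIntegral_const,
          Measure.restrict_apply measurableSet_Iio, Set.inter_comm, Set.Ioi_inter_Iio,
          Real.volume_Ioo, sub_zero]

lemma lintegral_mul_le_of_measure_inter_le (h𝒰 : 𝒰 ≤ mΩ) (h𝒱 : 𝒱 ≤ mΩ) {a : ℝ≥0∞}
    (h : ∀ U V, MeasurableSet[𝒰] U → MeasurableSet[𝒱] V → P (U ∩ V) ≤ P U * P V + a)
    {f g : Ω → ℝ} (hf : Measurable[𝒰] f) (hg : Measurable[𝒱] g) {M N : ℝ} (hf0 : ∀ ω, 0 ≤ f ω)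
    (hfM : ∀ ω, f ω ≤ M) (hg0 : ∀ ω, 0 ≤ g ω) (hgN : ∀ ω, g ω ≤ N) :
    ∫⁻ ω, ENNReal.ofReal (f ω * g ω) ∂P ≤
      (∫⁻ ω, ENNReal.ofReal (f ω) ∂P) * ∫⁻ ω, ENNReal.ofReal (g ω) ∂P +
        a * ENNReal.ofReal M * ENNReal.ofReal N := by
  have hfm : Measurable f := hf.mono h𝒰 le_rfl
  have hgm : Measurable g := hg.mono h𝒱 le_rfl
  have hset : ∀ s : ℝ, ∫⁻ ω in {ω | s < g ω}, ENNReal.ofReal (f ω) ∂P ≤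
      P {ω | s < g ω} * ∫⁻ ω, ENNReal.ofReal (f ω) ∂P + a * ENNReal.ofReal M := fun s ↦ by
    refine lintegral_le_of_measure_superlevel_le hfm hf0 hfM fun t _ ↦ ?_
    rw [Measure.restrict_apply (measurableSet_lt measurable_const hfm), mul_comm]
    exact h _ _ (hf measurableSet_Ioi) (hg measurableSet_Ioi)
  calc ∫⁻ ω, ENNReal.ofReal (f ω * g ω) ∂P
      = ∫⁻ ω, ENNReal.ofReal (g ω) ∂(P.withDensity fun ω ↦ ENNReal.ofReal (f ω)) := by
        rw [lintegral_withDensity_eq_lintegral_mul _ (by fun_prop) (by fun_prop)]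
        exact lintegral_congr fun ω ↦ ENNReal.ofReal_mul (hf0 ω)
    _ ≤ _ := by
        refine lintegral_le_of_measure_superlevel_le hgm hg0 hgN fun s _ ↦ ?_
        rw [withDensity_apply _ (measurableSet_lt measurable_const hgm), mul_comm]
        exact hset s

lemma memLp_of_nonneg_of_le [IsFiniteMeasure P] {f : Ω → ℝ} (hf : Measurable f)
    (hf0 : ∀ ω, 0 ≤ f ω) {M : ℝ} (hfM : ∀ ω, f ω ≤ M) (q : ℝ≥0∞) : MemLp f q P :=
  MemLp.of_bound hf.aestronglyMeasurable M
    (Eventually.of_forall fun ω ↦ (Real.norm_of_nonneg (hf0 ω)).trans_le (hfM ω))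

lemma covariance_le_mul_alphaCoeff [IsProbabilityMeasure P] (h𝒰 : 𝒰 ≤ mΩ) (h𝒱 : 𝒱 ≤ mΩ)
    {f g : Ω → ℝ} (hf : Measurable[𝒰] f) (hg : Measurable[𝒱] g) {M N : ℝ} (hf0 : ∀ ω, 0 ≤ f ω)
    (hfM : ∀ ω, f ω ≤ M) (hg0 : ∀ ω, 0 ≤ g ω) (hgN : ∀ ω, g ω ≤ N) :
    cov[f, g; P] ≤ M * N * alphaCoeff P 𝒰 𝒱 := by
  obtain ⟨ω₀⟩ := nonempty_of_isProbabilityMeasure P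
  have hM : 0 ≤ M := (hf0 ω₀).trans (hfM ω₀)
  have hN : 0 ≤ N := (hg0 ω₀).trans (hgN ω₀)
  have ha : 0 ≤ alphaCoeff P 𝒰 𝒱 := alphaCoeff_nonneg
  have hinter : ∀ U V, MeasurableSet[𝒰] U → MeasurableSet[𝒱] V →
      P (U ∩ V) ≤ P U * P V + ENNReal.ofReal (alphaCoeff P 𝒰 𝒱) := fun U V hU hV ↦ by
    rw [← ofReal_measureReal, ← ofReal_measureReal (s := U), ← ofReal_measureReal (s := V),
      ← ENNReal.ofReal_mul (by positivity), ← ENNReal.ofReal_add (by positivity) ha]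
    refine ENNReal.ofReal_le_ofReal ?_
    linarith [(abs_le.1 (le_alphaCoeff (P := P) hU hV)).1]
  have hfm := memLp_of_nonneg_of_le (P := P) (hf.mono h𝒰 le_rfl) hf0 hfM 2
  have hgm := memLp_of_nonneg_of_le (P := P) (hg.mono h𝒱 le_rfl) hg0 hgN 2
  have hfn : 0 ≤ P[f] := integral_nonneg hf0
  have hgn : 0 ≤ P[g] := integral_nonneg hg0
  have key := lintegral_mul_le_of_measure_inter_le h𝒰 h𝒱 hinter hf hg hf0 hfM hg0 hgN
  have hfg : Integrable (fun ω ↦ f ω * g ω) P := hfm.integrable_mul hgm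
  rw [← ofReal_integral_eq_lintegral_ofReal hfg
      (Eventually.of_forall fun ω ↦ mul_nonneg (hf0 ω) (hg0 ω)),
    ← ofReal_integral_eq_lintegral_ofReal (hfm.integrable one_le_two) (Eventually.of_forall hf0),
    ← ofReal_integral_eq_lintegral_ofReal (hgm.integrable one_le_two) (Eventually.of_forall hg0),
    ← ENNReal.ofReal_mul hfn, ← ENNReal.ofReal_mul ha, ← ENNReal.ofReal_mul (by positivity),
    ← ENNReal.ofReal_add (by positivity) (by positivity),
    ENNReal.ofReal_le_ofReal_iff (by positivity)] at key
  rw [covariance_eq_sub hfm hgm, sub_le_iff_le_add']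
  exact key.trans_eq (by ring)

lemma covariance_le_mul_integral [IsProbabilityMeasure P] {f g : Ω → ℝ} (hf : MemLp f 2 P)
    (hg : MemLp g 2 P) {M : ℝ} (hf0 : ∀ ω, 0 ≤ f ω) (hfM : ∀ ω, f ω ≤ M) (hg0 : ∀ ω, 0 ≤ g ω) :
    cov[f, g; P] ≤ M * P[g] := by
  have hmul : P[f * g] ≤ M * P[g] := by
    rw [← integral_const_mul]
    exact integral_mono (hf.integrable_mul hg) ((hg.integrable one_le_two).const_mul M)
      fun ω ↦ mul_le_mul_of_nonneg_right (hfM ω) (hg0 ω)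
  have hfn : 0 ≤ P[f] := integral_nonneg hf0
  have hgn : 0 ≤ P[g] := integral_nonneg hg0
  rw [covariance_eq_sub hf hg]
  linarith [mul_nonneg hfn hgn]

lemma sum_range_le_of_le_of_near_le {c : ℕ → ℝ} {A B : ℝ} (hA : 0 ≤ A) (hB : 0 ≤ B) (i L N : ℕ)
    (hfar : ∀ j, i + L < j ∨ j + L < i → c j ≤ A) (hnear : ∀ j, c j ≤ B) :
    ∑ j ∈ Finset.range N, c j ≤ N * A + (2 * L + 1) * B := by
  have hle : ∀ j, c j ≤ A + if j ∈ Finset.Icc (i - L) (i + L) then B else 0 := fun j ↦ by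
    split_ifs with hij
    · linarith [hnear j]
    · rw [Finset.mem_Icc] at hij
      rw [add_zero]
      exact hfar j (by omega)
  have hcard : ((Finset.range N).filter (· ∈ Finset.Icc (i - L) (i + L))).card ≤ 2 * L + 1 :=
    calc _ ≤ (Finset.Icc (i - L) (i + L)).card :=
          Finset.card_le_card fun j hj ↦ (Finset.mem_filter.1 hj).2
      _ ≤ 2 * L + 1 := by rw [Nat.card_Icc]; omega
  refine (Finset.sum_le_sum fun j _ ↦ hle j).trans ?_
  rw [Finset.sum_add_distrib, Finset.sum_const, Finset.card_range, nsmul_eq_mul,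
    ← Finset.sum_filter, Finset.sum_const, nsmul_eq_mul]
  gcongr
  exact_mod_cast hcard

lemma variance_sum_range_le [IsFiniteMeasure P] {W : ℕ → Ω → ℝ} (hW : ∀ j, MemLp (W j) 2 P)
    {b B : ℝ} (hb : 0 ≤ b) (hB : 0 ≤ B) {L : ℕ} (hfar : ∀ i j, i + L < j → cov[W i, W j; P] ≤ b)
    (hnear : ∀ i j, cov[W i, W j; P] ≤ B) (N : ℕ) :
    Var[∑ j ∈ Finset.range N, W j; P] ≤ N * (N * b + (2 * L + 1) * B) := by
  rw [variance_sum' fun j _ ↦ hW j]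
  refine (Finset.sum_le_sum fun i _ ↦ sum_range_le_of_le_of_near_le hb hB i L N (fun j hij ↦ ?_)
    (hnear i)).trans_eq ?_
  · rcases hij with hij | hij
    · exact hfar i j hij
    · rw [covariance_comm]
      exact hfar j i hij
  · rw [Finset.sum_const, Finset.card_range, nsmul_eq_mul]

lemma measure_sum_le_half_le [IsProbabilityMeasure P] {W : ℕ → Ω → ℝ} (hW : ∀ j, Measurable (W j))
    {M w b : ℝ} (hW0 : ∀ j ω, 0 ≤ W j ω) (hWM : ∀ j ω, W j ω ≤ M) (hw : 0 < w)
    (hmean : ∀ j, P[W j] = w) (hb : 0 ≤ b) {L : ℕ}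
    (hcov : ∀ i j, i + L < j → cov[W i, W j; P] ≤ b) {N : ℕ} (hN : 0 < N) :
    P {ω | ∑ j ∈ Finset.range N, W j ω ≤ N * w / 2} ≤
      ENNReal.ofReal (4 * ((2 * L + 1) * M / (N * w) + b / w ^ 2)) := by
  obtain ⟨ω₀⟩ := nonempty_of_isProbabilityMeasure P
  have hM : 0 ≤ M := (hW0 0 ω₀).trans (hWM 0 ω₀)
  have hmem : ∀ j, MemLp (W j) 2 P := fun j ↦ memLp_of_nonneg_of_le (hW j) (hW0 j) (hWM j) 2
  have hnear : ∀ i j, cov[W i, W j; P] ≤ M * w := fun i j ↦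
    hmean j ▸ covariance_le_mul_integral (hmem i) (hmem j) (hW0 i) (hWM i) (hW0 j)
  set S : Ω → ℝ := ∑ j ∈ Finset.range N, W j
  have hSmem : MemLp S 2 P := memLp_finsetSum' _ fun j _ ↦ hmem j
  have hSmean : P[S] = N * w := by
    simp only [S, Finset.sum_apply]
    rw [integral_finsetSum _ fun j _ ↦ (hmem j).integrable one_le_two]
    simp [hmean]
  have hvar : Var[S; P] ≤ N * (N * b + (2 * L + 1) * (M * w)) :=
    variance_sum_range_le hmem hb (by positivity) hcov hnear N
  have hpos : 0 < N * w / 2 := by positivity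
  refine le_trans (measure_mono fun ω hω ↦ ?_)
    ((meas_ge_le_variance_div_sq hSmem hpos).trans (ENNReal.ofReal_le_ofReal ?_))
  · rw [Set.mem_ofPred_eq, ← Finset.sum_apply] at hω
    rw [Set.mem_ofPred_eq, hSmean, abs_sub_comm]
    exact le_trans (by linarith) (le_abs_self _)
  · calc Var[S; P] / (N * w / 2) ^ 2
        ≤ N * (N * b + (2 * L + 1) * (M * w)) / (N * w / 2) ^ 2 := by gcongr
      _ = _ := by field_simp; ring

end Covariance

/-! ### Sums over overlapping blocks -/

lemma ae_eventually_notMem_of_measure_le_exp {Ω : Type*} [MeasurableSpace Ω] {P : Measure Ω}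
    [IsFiniteMeasure P] {s : ℕ → Set Ω} {C θ : ℝ} (hθ : 0 < θ)
    (h : ∀ᶠ n : ℕ in atTop, P (s n) ≤ ENNReal.ofReal (C * Real.exp (n * -θ))) :
    ∀ᵐ ω ∂P, ∀ᶠ n in atTop, ω ∉ s n := by
  have hgeom : Summable fun n : ℕ ↦ |C| * Real.exp (n * -θ) :=
    (Real.summable_exp_nat_mul_iff.2 (by linarith)).mul_left _
  have hsum : Summable fun n ↦ P.real (s n) := by
    refine Summable.of_norm_bounded_eventually_nat hgeom ?_
    filter_upwards [h] with n hn
    rw [Real.norm_of_nonneg measureReal_nonneg]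
    refine ENNReal.toReal_le_of_le_ofReal (by positivity) (hn.trans (ENNReal.ofReal_le_ofReal ?_))
    gcongr
    exact le_abs_self C
  refine ae_eventually_notMem ?_
  simpa using hsum.tsum_ofReal_ne_top

section Blocks

variable {Ω E Y Z : Type*}

lemma shift_iterate_apply (m : ℕ) (x : ℕ → E) (i : ℕ) : shift^[m] x i = x (i + m) := by
  induction m generalizing x with
  | zero => rfl
  | succ m ih => rw [Function.iterate_succ_apply, ih, shift, add_assoc]

/-- The sequence `z` with all coordinates from `N` on replaced by `e`. Composing a measurable
function that depends only on the first `N` coordinates with this map makes its measurability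
with respect to these coordinates visible. -/
def truncSeq (e : E) (N : ℕ) (z : ℕ → E) : ℕ → E := fun i ↦ if i < N then z i else e

lemma dependsOnFirst_truncSeq (e : E) (N : ℕ) : DependsOnFirst (truncSeq e N) N := by
  intro z z' h
  ext i
  by_cases hi : i < N
  · simp only [truncSeq, hi, if_true, h i hi]
  · simp only [truncSeq, hi, if_false]

lemma DependsOnFirst.comp_left {g : (ℕ → E) → Y} {N : ℕ} (hg : DependsOnFirst g N) (f : Y → Z) :
    DependsOnFirst (fun z ↦ f (g z)) N :=
  fun z z' h ↦ congrArg f (hg z z' h)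

lemma DependsOnFirst.apply_truncSeq {g : (ℕ → E) → Y} {N : ℕ} (hg : DependsOnFirst g N) (e : E)
    (z : ℕ → E) : g (truncSeq e N z) = g z :=
  hg _ _ fun i hi ↦ by simp only [truncSeq, hi, if_true]

variable [mE : MeasurableSpace E] {X : ℕ → Ω → E}

lemma measurable_shift : Measurable (shift : (ℕ → E) → ℕ → E) :=
  measurable_pi_iff.2 fun i ↦ measurable_pi_apply (i + 1)

lemma measurable_truncSeq_shift_iterate {𝒰 : MeasurableSpace Ω} (e : E) (m N : ℕ)
    (h𝒰 : ∀ k, m ≤ k → k < m + N → mE.comap (X k) ≤ 𝒰) :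
    Measurable[𝒰] fun ω ↦ truncSeq e N (shift^[m] fun i ↦ X i ω) := by
  refine measurable_pi_iff.2 fun i ↦ ?_
  by_cases h : i < N
  · simp only [truncSeq, h, if_true, shift_iterate_apply]
    exact Measurable.of_comap_le (h𝒰 _ (by omega) (by omega))
  · simp only [truncSeq, h, if_false]
    exact measurable_const

lemma measurable_truncSeq (e : E) (N : ℕ) : Measurable (truncSeq e N) :=
  measurable_truncSeq_shift_iterate (X := fun i (z : ℕ → E) ↦ z i) e 0 N fun k _ _ ↦
    (measurable_pi_apply k).comap_le

lemma DependsOnFirst.measurable_shift_iterate [MeasurableSpace Y] {g : (ℕ → E) → Y} {N : ℕ}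
    (hg : DependsOnFirst g N) (hgm : Measurable g) {𝒰 : MeasurableSpace Ω} (m : ℕ)
    (h𝒰 : ∀ k, m ≤ k → k < m + N → mE.comap (X k) ≤ 𝒰) :
    Measurable[𝒰] fun ω ↦ g (shift^[m] fun i ↦ X i ω) := by
  rcases isEmpty_or_nonempty Ω with hΩ | ⟨⟨ω₀⟩⟩
  · exact measurable_of_empty _
  · simp_rw [← hg.apply_truncSeq (X 0 ω₀) (shift^[m] _)]
    exact hgm.comp (measurable_truncSeq_shift_iterate (X 0 ω₀) m N h𝒰)

variable [mΩ : MeasurableSpace Ω] {P : Measure Ω}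

lemma IsStationary.identDistrib_shift_iterate (hX : ∀ i, Measurable (X i))
    (hstat : IsStationary P X) (m : ℕ) :
    IdentDistrib (fun ω ↦ shift^[m] fun i ↦ X i ω) (fun ω i ↦ X i ω) P P := by
  have hx : Measurable fun ω i ↦ X i ω := measurable_pi_iff.2 hX
  have hpres : MeasurePreserving shift (P.map fun ω i ↦ X i ω) (P.map fun ω i ↦ X i ω) :=
    ⟨measurable_shift, (Measure.map_map measurable_shift hx).trans hstat⟩
  refine ⟨((measurable_shift.iterate m).comp hx).aemeasurable, hx.aemeasurable, ?_⟩
  exact (Measure.map_map (measurable_shift.iterate m) hx).symm.trans (hpres.iterate m).map_eq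

variable [IsProbabilityMeasure P] {v : (ℕ → E) → ℝ} {M : ℝ} {n : ℕ}

-- The `i`-th block reads the coordinates before `(i + 2) n`; the `j`-th one starts at `j n`.
lemma covariance_block_le (hX : ∀ i, Measurable (X i)) (hv : Measurable v)
    (hdep : DependsOnFirst v (2 * n)) (hv0 : ∀ z, 0 ≤ v z) (hvM : ∀ z, v z ≤ M) (hn : 1 ≤ n)
    {i j L : ℕ} (hij : i + (L + 1) < j) :
    cov[fun ω ↦ v (shift^[i * n] fun i ↦ X i ω), fun ω ↦ v (shift^[j * n] fun i ↦ X i ω); P] ≤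
      M ^ 2 * mixingCoeff P X (L * n + 1) := by
  have hblocks : (i + (L + 2)) * n ≤ j * n := Nat.mul_le_mul_right n hij
  have hgap : i * n + 2 * n - 1 + (L * n + 1) ≤ j * n := by
    rw [add_mul, add_mul] at hblocks
    omega
  have hcov := covariance_le_mul_alphaCoeff (P := P)
    (𝒰 := ⨆ k ∈ Set.Iic (i * n + 2 * n - 1), mE.comap (X k))
    (𝒱 := ⨆ k ∈ Set.Ici (i * n + 2 * n - 1 + (L * n + 1)), mE.comap (X k))
    (iSup₂_le fun k _ ↦ (hX k).comap_le) (iSup₂_le fun k _ ↦ (hX k).comap_le)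
    (hdep.measurable_shift_iterate hv (i * n) fun k _ _ ↦
      le_iSup₂_of_le k (by simp only [Set.mem_Iic]; omega) le_rfl)
    (hdep.measurable_shift_iterate hv (j * n) fun k _ _ ↦
      le_iSup₂_of_le k (by simp only [Set.mem_Ici]; omega) le_rfl)
    (fun _ ↦ hv0 _) (fun _ ↦ hvM _) (fun _ ↦ hv0 _) (fun _ ↦ hvM _)
  rw [← pow_two] at hcov
  exact hcov.trans (mul_le_mul_of_nonneg_left
    (alphaCoeff_le_mixingCoeff X (Nat.succ_ne_zero (L * n)) _) (sq_nonneg M))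

lemma measure_blockSum_le_half_le (hX : ∀ i, Measurable (X i)) (hstat : IsStationary P X)
    (hv : Measurable v) (hdep : DependsOnFirst v (2 * n)) (hv0 : ∀ z, 0 ≤ v z)
    (hvM : ∀ z, v z ≤ M) (hn : 1 ≤ n) (L : ℕ) {w : ℝ} (hw : 0 < w)
    (hmean : ∫ ω, v (fun i ↦ X i ω) ∂P = w) {N : ℕ} (hN : 0 < N) :
    P {ω | ∑ j ∈ Finset.range N, v (shift^[j * n] fun i ↦ X i ω) ≤ N * w / 2} ≤
      ENNReal.ofReal (4 * ((2 * L + 3) * M / (N * w) +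
        M ^ 2 * mixingCoeff P X (L * n + 1) / w ^ 2)) := by
  have hident := fun j : ℕ ↦ (hstat.identDistrib_shift_iterate hX (j * n)).comp hv
  have hmeas : ∀ j : ℕ, Measurable fun ω ↦ v (shift^[j * n] fun i ↦ X i ω) := fun j ↦
    hv.comp ((measurable_shift.iterate (j * n)).comp (measurable_pi_iff.2 hX))
  have hchebyshev := measure_sum_le_half_le (P := P) hmeas (fun _ _ ↦ hv0 _) (fun _ _ ↦ hvM _) hw
    (fun j ↦ (hident j).integral_eq.trans hmean)
    (mul_nonneg (sq_nonneg M) (mixingCoeff_nonneg X (L * n + 1))) (L := L + 1)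
    (fun _ _ hij ↦ covariance_block_le hX hv hdep hv0 hvM hn hij) hN
  convert hchebyshev using 6
  push_cast
  ring

end Blocks

section Truncation

variable {Ω : Type*} [MeasurableSpace Ω] {P : Measure Ω}

lemma lintegral_exp_le_mul_of_le_add {f g : Ω → ℝ} {c : ℝ} (h : ∀ ω, f ω ≤ c + g ω) :
    ∫⁻ ω, ENNReal.ofReal (Real.exp (f ω)) ∂P ≤
      ENNReal.ofReal (Real.exp c) * ∫⁻ ω, ENNReal.ofReal (Real.exp (g ω)) ∂P := by
  rw [← lintegral_const_mul' _ _ ENNReal.ofReal_ne_top]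
  refine lintegral_mono fun ω ↦ ?_
  rw [← ENNReal.ofReal_mul (by positivity), ← Real.exp_add]
  exact ENNReal.ofReal_le_ofReal (Real.exp_le_exp.2 (h ω))

lemma lintegral_exp_le_lintegral_min_add {u : Ω → ℝ} (hu : Measurable u) (b : ℝ) {p : ℝ}
    (hp : 1 ≤ p) :
    ∫⁻ ω, ENNReal.ofReal (Real.exp (u ω)) ∂P ≤
      ∫⁻ ω, ENNReal.ofReal (min (Real.exp (u ω)) (Real.exp b)) ∂P +
        ENNReal.ofReal (Real.exp (-((p - 1) * b))) *
          ∫⁻ ω, ENNReal.ofReal (Real.exp (p * u ω)) ∂P := by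
  rw [← lintegral_const_mul' _ _ ENNReal.ofReal_ne_top, ← lintegral_add_left (by fun_prop)]
  refine lintegral_mono fun ω ↦ ?_
  rcases le_or_gt (u ω) b with h | h
  · rw [min_eq_left (Real.exp_le_exp.2 h)]
    exact le_self_add
  · rw [← ENNReal.ofReal_mul (by positivity), ← Real.exp_add]
    refine le_trans (ENNReal.ofReal_le_ofReal (Real.exp_le_exp.2 ?_)) le_add_self
    nlinarith

lemma half_le_integral_min_exp [IsFiniteMeasure P] {u : Ω → ℝ} (hu : Measurable u)
    {A B b p : ℝ} (hp : 1 ≤ p) (hB : 0 ≤ B)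
    (hA : ENNReal.ofReal A ≤ ∫⁻ ω, ENNReal.ofReal (Real.exp (u ω)) ∂P)
    (hmom : ∫⁻ ω, ENNReal.ofReal (Real.exp (p * u ω)) ∂P ≤ ENNReal.ofReal B)
    (hAB : 2 * (Real.exp (-((p - 1) * b)) * B) ≤ A) :
    A / 2 ≤ ∫ ω, min (Real.exp (u ω)) (Real.exp b) ∂P := by
  have hint : Integrable (fun ω ↦ min (Real.exp (u ω)) (Real.exp b)) P :=
    (memLp_of_nonneg_of_le (by fun_prop) (fun ω ↦ by positivity) (fun ω ↦ min_le_right _ _)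
      1).integrable le_rfl
  have hnonneg : 0 ≤ ∫ ω, min (Real.exp (u ω)) (Real.exp b) ∂P :=
    integral_nonneg fun ω ↦ by positivity
  have hsplit : ENNReal.ofReal A ≤ ENNReal.ofReal (∫ ω, min (Real.exp (u ω)) (Real.exp b) ∂P +
      Real.exp (-((p - 1) * b)) * B) := by
    refine hA.trans ((lintegral_exp_le_lintegral_min_add hu b hp).trans ?_)
    rw [ENNReal.ofReal_add hnonneg (by positivity), ENNReal.ofReal_mul (by positivity),
      ofReal_integral_eq_lintegral_ofReal hint (Eventually.of_forall fun ω ↦ by positivity)]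
    gcongr
  linarith [(ENNReal.ofReal_le_ofReal_iff (by positivity)).1 hsplit]

end Truncation

/-! ### Moments of the empirical laws -/

section Functionals

variable {E V : Type*} [NormedAddCommGroup V] {SΦ SΨ : ℕ → (ℕ → E) → V}

/-- The functionals `SΦ n` and `SΨ n` differ by `o(n)`, uniformly on the sequence space. -/
def IsUniformlyClose (SΦ SΨ : ℕ → (ℕ → E) → V) : Prop :=
  ∀ η : ℝ, 0 < η → ∀ᶠ n : ℕ in atTop, ∀ z, ‖SΦ n z - SΨ n z‖ ≤ n * η

lemma IsUniformlyClose.symm (h : IsUniformlyClose SΦ SΨ) : IsUniformlyClose SΨ SΦ := fun η hη ↦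
  (h η hη).mono fun _ hn z ↦ (norm_sub_rev _ _).trans_le (hn z)

lemma isUniformlyClose_of_tendsto_iSup_div
    (h : Tendsto (fun n : ℕ ↦ (⨆ z : ℕ → E, ‖SΦ n z - SΨ n z‖ₑ) / (n : ℝ≥0∞)) atTop (𝓝 0)) :
    IsUniformlyClose SΦ SΨ := by
  intro η hη
  filter_upwards [h.eventually_lt_const (ENNReal.ofReal_pos.2 hη), eventually_ge_atTop 1]
    with n hlt hn z
  have hn0 : (n : ℝ≥0∞) ≠ 0 := by exact_mod_cast (by omega : n ≠ 0)
  rw [ENNReal.div_lt_iff (Or.inl hn0) (Or.inl (ENNReal.natCast_ne_top n)), mul_comm,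
    ← ENNReal.ofReal_natCast, ← ENNReal.ofReal_mul (by positivity)] at hlt
  rw [← ENNReal.ofReal_le_ofReal_iff (by positivity), ofReal_norm]
  exact (le_iSup (fun z : ℕ → E ↦ ‖SΦ n z - SΨ n z‖ₑ) z).trans hlt.le

lemma IsUniformlyClose.comp_truncSeq {N : ℕ → ℕ} (h : IsUniformlyClose SΦ SΨ)
    (hdep : ∀ n, 1 ≤ n → DependsOnFirst (SΨ n) (N n)) (e : E) :
    IsUniformlyClose SΦ fun n z ↦ SΦ n (truncSeq e (N n) z) := by
  intro η hη
  filter_upwards [h (η / 2) (half_pos hη), eventually_ge_atTop 1] with n hclose hn z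
  have htrunc := hclose (truncSeq e (N n) z)
  rw [(hdep n hn).apply_truncSeq e z] at htrunc
  calc ‖SΦ n z - SΦ n (truncSeq e (N n) z)‖
      = ‖(SΦ n z - SΨ n z) - (SΦ n (truncSeq e (N n) z) - SΨ n z)‖ := by
        rw [sub_sub_sub_cancel_right]
    _ ≤ ‖SΦ n z - SΨ n z‖ + ‖SΦ n (truncSeq e (N n) z) - SΨ n z‖ := norm_sub_le _ _
    _ ≤ n * (η / 2) + n * (η / 2) := add_le_add (hclose z) htrunc
    _ = n * η := by ring

lemma IsUniformlyClose.eventually_inner_le_add [InnerProductSpace ℝ V]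
    (h : IsUniformlyClose SΦ SΨ) (l : V) {γ : ℝ} (hγ : 0 < γ) :
    ∀ᶠ n : ℕ in atTop, ∀ z, inner ℝ l (SΦ n z) ≤ n * γ + inner ℝ l (SΨ n z) := by
  filter_upwards [h (γ / (‖l‖ + 1)) (by positivity)] with n hclose z
  rw [← sub_le_iff_le_add, ← inner_sub_right]
  calc inner ℝ l (SΦ n z - SΨ n z) ≤ ‖l‖ * ‖SΦ n z - SΨ n z‖ := real_inner_le_norm _ _
    _ ≤ (‖l‖ + 1) * (n * (γ / (‖l‖ + 1))) := by
      gcongr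
      · linarith
      · exact hclose z
    _ = n * γ := by field_simp

end Functionals

section Moments

variable {E V : Type*} [NormedAddCommGroup V] [InnerProductSpace ℝ V] {n : ℕ}

lemma natCast_mul_inner_inv_smul (hn : 1 ≤ n) (l y : V) :
    (n : ℝ) * inner ℝ l ((n : ℝ)⁻¹ • y) = inner ℝ l y := by
  rw [real_inner_smul_right, mul_inv_cancel_left₀ (by positivity)]

variable [MeasurableSpace V] [BorelSpace V] {SΦ SΨ : ℕ → (ℕ → E) → V} {k : ℕ → ℕ}

lemma expMoment_empiricalLaw (x : ℕ → E) (hn : 1 ≤ n) (l : V) :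
    expMoment (empiricalLaw SΦ k x n) n l = (k n : ℝ≥0∞)⁻¹ *
      ∑ j ∈ Finset.range (k n), ENNReal.ofReal (Real.exp (inner ℝ l (SΦ n (shift^[j * n] x)))) := by
  rw [expMoment, empiricalLaw, lintegral_smul_measure, lintegral_finsetSum_measure, smul_eq_mul]
  congr 1
  refine Finset.sum_congr rfl fun j _ ↦ ?_
  rw [lintegral_dirac' _ (measurable_ofReal_exp_mul_inner n l), natCast_mul_inner_inv_smul hn]

lemma IsUniformlyClose.eventually_expMoment_empiricalLaw_le (h : IsUniformlyClose SΦ SΨ)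
    (x : ℕ → E) (l : V) {γ : ℝ} (hγ : 0 < γ) :
    ∀ᶠ n : ℕ in atTop, expMoment (empiricalLaw SΦ k x n) n l ≤
      ENNReal.ofReal (Real.exp (n * γ)) * expMoment (empiricalLaw SΨ k x n) n l := by
  filter_upwards [h.eventually_inner_le_add l hγ, eventually_ge_atTop 1] with n hle hn
  rw [expMoment_empiricalLaw x hn, expMoment_empiricalLaw x hn, mul_left_comm]
  refine mul_le_mul' le_rfl ?_
  rw [Finset.mul_sum]
  refine Finset.sum_le_sum fun j _ ↦ ?_
  rw [← ENNReal.ofReal_mul (by positivity), ← Real.exp_add]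
  exact ENNReal.ofReal_le_ofReal (Real.exp_le_exp.2 (hle _))

variable {Ω : Type*} [mΩ : MeasurableSpace Ω] [mE : MeasurableSpace E] {P : Measure Ω}
  {X : ℕ → Ω → E}

lemma expMoment_scaledLaw (hX : ∀ i, Measurable (X i)) (hn : 1 ≤ n) (hSΦ : Measurable (SΦ n))
    (l : V) : expMoment (scaledLaw P X SΦ n) n l =
      ∫⁻ ω, ENNReal.ofReal (Real.exp (inner ℝ l (SΦ n fun i ↦ X i ω))) ∂P := by
  have hm : Measurable fun ω ↦ (n : ℝ)⁻¹ • SΦ n fun i ↦ X i ω :=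
    (hSΦ.comp (measurable_pi_iff.2 hX)).const_smul (n : ℝ)⁻¹
  rw [expMoment, scaledLaw, lintegral_map (measurable_ofReal_exp_mul_inner n l) hm]
  simp_rw [natCast_mul_inner_inv_smul hn]

lemma IsUniformlyClose.eventually_expMoment_scaledLaw_le (h : IsUniformlyClose SΦ SΨ)
    (hX : ∀ i, Measurable (X i)) (hSΦ : ∀ n, 1 ≤ n → Measurable (SΦ n))
    (hSΨ : ∀ n, 1 ≤ n → Measurable (SΨ n)) (l : V) {γ : ℝ} (hγ : 0 < γ) :
    ∀ᶠ n : ℕ in atTop, expMoment (scaledLaw P X SΦ n) n l ≤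
      ENNReal.ofReal (Real.exp (n * γ)) * expMoment (scaledLaw P X SΨ n) n l := by
  filter_upwards [h.eventually_inner_le_add l hγ, eventually_ge_atTop 1] with n hle hn
  rw [expMoment_scaledLaw hX hn (hSΦ n hn), expMoment_scaledLaw hX hn (hSΨ n hn)]
  exact lintegral_exp_le_mul_of_le_add fun ω ↦ hle _

lemma measurable_exp_inner (hSΦ : Measurable (SΦ n)) (l : V) :
    Measurable fun z ↦ ENNReal.ofReal (Real.exp (inner ℝ l (SΦ n z))) :=
  ((innerSL ℝ l).continuous.measurable.comp hSΦ).exp.ennreal_ofReal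

lemma measurable_exp_inner_shift_iterate (hX : ∀ i, Measurable (X i)) (hSΦ : Measurable (SΦ n))
    (l : V) (m : ℕ) : Measurable fun ω ↦
      ENNReal.ofReal (Real.exp (inner ℝ l (SΦ n (shift^[m] fun i ↦ X i ω)))) :=
  (measurable_exp_inner hSΦ l).comp ((measurable_shift.iterate m).comp (measurable_pi_iff.2 hX))

lemma measurable_expMoment_empiricalLaw (hX : ∀ i, Measurable (X i)) (hn : 1 ≤ n)
    (hSΦ : Measurable (SΦ n)) (l : V) :
    Measurable fun ω ↦ expMoment (empiricalLaw SΦ k (fun i ↦ X i ω) n) n l := by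
  simp_rw [expMoment_empiricalLaw _ hn]
  exact (Finset.measurable_fun_sum _ fun j _ ↦
    measurable_exp_inner_shift_iterate hX hSΦ l (j * n)).const_mul _

lemma lintegral_expMoment_empiricalLaw (hX : ∀ i, Measurable (X i)) (hstat : IsStationary P X)
    (hn : 1 ≤ n) (hSΦ : Measurable (SΦ n)) (hk : 0 < k n) (l : V) :
    ∫⁻ ω, expMoment (empiricalLaw SΦ k (fun i ↦ X i ω) n) n l ∂P =
      expMoment (scaledLaw P X SΦ n) n l := by
  have hmeas := fun j : ℕ ↦ measurable_exp_inner_shift_iterate hX hSΦ l (j * n)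
  have hmean : ∀ j : ℕ, ∫⁻ ω,
      ENNReal.ofReal (Real.exp (inner ℝ l (SΦ n (shift^[j * n] fun i ↦ X i ω)))) ∂P =
        expMoment (scaledLaw P X SΦ n) n l := fun j ↦
    ((hstat.identDistrib_shift_iterate hX (j * n)).comp (measurable_exp_inner hSΦ l)).lintegral_eq
      |>.trans (expMoment_scaledLaw hX hn hSΦ l).symm
  simp_rw [expMoment_empiricalLaw _ hn]
  rw [lintegral_const_mul _ (Finset.measurable_fun_sum _ fun j _ ↦ hmeas j),
    lintegral_finsetSum _ fun j _ ↦ hmeas j]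
  simp_rw [hmean]
  rw [Finset.sum_const, Finset.card_range, nsmul_eq_mul,
    ENNReal.inv_mul_cancel_left (by exact_mod_cast hk.ne') (ENNReal.natCast_ne_top _)]

end Moments

section UpperBound

open ExpGrowth

variable {Ω E V : Type*} [MeasurableSpace Ω] [MeasurableSpace E] [NormedAddCommGroup V]
  [InnerProductSpace ℝ V] [MeasurableSpace V] [BorelSpace V] {P : Measure Ω} [IsFiniteMeasure P]
  {X : ℕ → Ω → E} {SΦ : ℕ → (ℕ → E) → V} {k : ℕ → ℕ} {l : V}

lemma ae_expGrowthSup_expMoment_empiricalLaw_le_of_lt (hX : ∀ i, Measurable (X i))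
    (hstat : IsStationary P X) (hSΦ : ∀ n, 1 ≤ n → Measurable (SΦ n))
    (hkpos : ∀ n, 1 ≤ n → 0 < k n) {r : ℝ}
    (hr : expGrowthSup (fun n ↦ expMoment (scaledLaw P X SΦ n) n l) < r) :
    ∀ᵐ ω ∂P, expGrowthSup
      (fun n ↦ expMoment (empiricalLaw SΦ k (fun i ↦ X i ω) n) n l) ≤ r := by
  obtain ⟨A, hA, hAr⟩ := EReal.lt_iff_exists_real_btwn.1 hr
  have hAr' : A < r := by exact_mod_cast hAr
  have hmarkov : ∀ᶠ n : ℕ in atTop, P {ω | ENNReal.ofReal (Real.exp (n * r)) ≤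
      expMoment (empiricalLaw SΦ k (fun i ↦ X i ω) n) n l} ≤
        ENNReal.ofReal (1 * Real.exp (n * -(r - A))) := by
    filter_upwards [eventually_lt_exp_of_expGrowthSup_lt hA, eventually_ge_atTop 1] with n hmom hn
    refine (meas_ge_le_lintegral_div
      (measurable_expMoment_empiricalLaw hX hn (hSΦ n hn) l).aemeasurable
      (ENNReal.ofReal_pos.2 (Real.exp_pos _)).ne' ENNReal.ofReal_ne_top).trans ?_
    rw [lintegral_expMoment_empiricalLaw hX hstat hn (hSΦ n hn) (hkpos n hn)]
    refine (ENNReal.div_le_div_right hmom.le _).trans_eq ?_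
    rw [← ENNReal.ofReal_div_of_pos (Real.exp_pos _), ← Real.exp_sub]
    ring_nf
  filter_upwards [ae_eventually_notMem_of_measure_le_exp (sub_pos.2 hAr') hmarkov] with ω hω
  exact expGrowthSup_le_of_eventually_le_exp (hω.mono fun n hn ↦ (not_le.1 hn).le)

lemma ae_expGrowthSup_expMoment_empiricalLaw_le (hX : ∀ i, Measurable (X i))
    (hstat : IsStationary P X) (hSΦ : ∀ n, 1 ≤ n → Measurable (SΦ n))
    (hkpos : ∀ n, 1 ≤ n → 0 < k n) (l : V) :
    ∀ᵐ ω ∂P, expGrowthSup (fun n ↦ expMoment (empiricalLaw SΦ k (fun i ↦ X i ω) n) n l) ≤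
      expGrowthSup (fun n ↦ expMoment (scaledLaw P X SΦ n) n l) := by
  have hrat : ∀ᵐ ω ∂P, ∀ q : {q : ℚ //
      expGrowthSup (fun n ↦ expMoment (scaledLaw P X SΦ n) n l) < ((q : ℝ) : EReal)},
      expGrowthSup (fun n ↦ expMoment (empiricalLaw SΦ k (fun i ↦ X i ω) n) n l) ≤
        (((q : ℚ) : ℝ) : EReal) :=
    ae_all_iff.2 fun q ↦ ae_expGrowthSup_expMoment_empiricalLaw_le_of_lt hX hstat hSΦ hkpos q.2
  filter_upwards [hrat] with ω hω
  by_contra! hlt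
  obtain ⟨q, hq, hqω⟩ := EReal.lt_iff_exists_rat_btwn.1 hlt
  exact (hω ⟨q, hq⟩).not_gt hqω

end UpperBound

section LowerBound

open ExpGrowth

lemma exists_truncation_parameters {p r s κ ε : ℝ} (hp : 1 < p) (hgap : s - p * r < (p - 1) * κ)
    (hε : 0 < ε) : ∃ b δ h : ℝ, 0 < δ ∧ 0 < h ∧ δ < ε ∧ s + 2 * δ - (p - 1) * b < r ∧
      b + 3 * δ ≤ r + κ ∧ 2 * b + 3 * δ ≤ 2 * r + δ * h := by
  have hp' : 0 < p - 1 := sub_pos.2 hp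
  obtain ⟨b, hb, hbκ⟩ : ∃ b, (s - r) / (p - 1) < b ∧ b < r + κ := by
    refine exists_between ((div_lt_iff₀ hp').2 ?_)
    linarith
  rw [div_lt_iff₀ hp'] at hb
  obtain ⟨δ, hδ, hδmin⟩ : ∃ δ, 0 < δ ∧ δ < min ε (min ((b * (p - 1) - (s - r)) / 2)
      ((r + κ - b) / 3)) :=
    exists_between (lt_min hε (lt_min (by linarith) (by linarith)))
  obtain ⟨hδε, hδb, hδκ⟩ : δ < ε ∧ δ < (b * (p - 1) - (s - r)) / 2 ∧ δ < (r + κ - b) / 3 := by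
    simpa only [lt_min_iff] using hδmin
  refine ⟨b, δ, (|2 * b + 3 * δ - 2 * r| + 1) / δ, hδ, by positivity, hδε, by linarith,
    by linarith, ?_⟩
  rw [mul_div_cancel₀ _ hδ.ne']
  linarith [le_abs_self (2 * b + 3 * δ - 2 * r)]

lemma chebyshev_exp_bound {n b δ h r κ C k w α : ℝ} (hn : 0 ≤ n) (hδ : 0 ≤ δ) (hC : 0 ≤ C)
    (hbκ : b + 3 * δ ≤ r + κ) (hbh : 2 * b + 3 * δ ≤ 2 * r + δ * h) (hk : Real.exp (n * κ) ≤ k)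
    (hw : Real.exp (n * (r - δ)) / 2 ≤ w) (hα : α ≤ C * Real.exp (-(n * (δ * h)))) :
    (2 * ⌈Real.exp (n * δ)⌉₊ + 3) * Real.exp (n * b) / (k * w) +
      Real.exp (n * b) ^ 2 * α / w ^ 2 ≤ (14 + 4 * C) * Real.exp (n * -δ) := by
  have hceil : 2 * (⌈Real.exp (n * δ)⌉₊ : ℝ) + 3 ≤ 7 * Real.exp (n * δ) := by
    have hlt := Nat.ceil_lt_add_one (Real.exp_pos (n * δ)).le
    have hone : 1 ≤ Real.exp (n * δ) := Real.one_le_exp (by positivity)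
    linarith
  have hk0 : 0 < k := (Real.exp_pos _).trans_le hk
  have hfirst : (2 * ⌈Real.exp (n * δ)⌉₊ + 3) * Real.exp (n * b) / (k * w) ≤
      14 * Real.exp (n * -δ) := by
    calc (2 * ⌈Real.exp (n * δ)⌉₊ + 3) * Real.exp (n * b) / (k * w)
        ≤ 7 * Real.exp (n * δ) * Real.exp (n * b) /
            (Real.exp (n * κ) * (Real.exp (n * (r - δ)) / 2)) := by gcongr
      _ = 14 * Real.exp (n * (b + 2 * δ - (r + κ))) := by
        rw [show n * (b + 2 * δ - (r + κ)) = n * δ + n * b - (n * κ + n * (r - δ)) by ring,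
          Real.exp_sub, Real.exp_add, Real.exp_add]
        ring
      _ ≤ 14 * Real.exp (n * -δ) := by
        gcongr
        linarith
  have hsecond : Real.exp (n * b) ^ 2 * α / w ^ 2 ≤ 4 * C * Real.exp (n * -δ) := by
    calc Real.exp (n * b) ^ 2 * α / w ^ 2
        ≤ Real.exp (n * b) ^ 2 * (C * Real.exp (-(n * (δ * h)))) /
            (Real.exp (n * (r - δ)) / 2) ^ 2 := by gcongr
      _ = 4 * C * Real.exp (n * (2 * b + 2 * δ - (2 * r + δ * h))) := by
        rw [show n * (2 * b + 2 * δ - (2 * r + δ * h)) =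
          n * b + n * b + -(n * (δ * h)) - (n * (r - δ) + n * (r - δ)) by ring,
          Real.exp_sub, Real.exp_add, Real.exp_add, Real.exp_add]
        ring
      _ ≤ 4 * C * Real.exp (n * -δ) := by
        gcongr
        linarith
  linarith

section

variable {Ω E : Type*} [MeasurableSpace Ω] [MeasurableSpace E] {P : Measure Ω}
  [IsProbabilityMeasure P]

lemma exists_mixingCoeff_ceil_exp_le (X : ℕ → Ω → E) {h : ℝ} (hh : 0 ≤ h)
    (hmix : ∫⁻ u in Set.Icc (0 : ℝ) 1, mixingInv P X u ^ h < ⊤) (δ : ℝ) :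
    ∃ C, 0 ≤ C ∧ ∀ n : ℕ, 1 ≤ n →
      mixingCoeff P X (⌈Real.exp (n * δ)⌉₊ * n + 1) ≤ C * Real.exp (-(n * (δ * h))) := by
  obtain ⟨C, hC0, hC⟩ := exists_mixingCoeff_le_mul_rpow X hh hmix
  refine ⟨C, hC0, fun n hn ↦ (hC _ (Nat.succ_ne_zero _)).trans ?_⟩
  have hle : Real.exp (n * δ) ≤ ((⌈Real.exp (n * δ)⌉₊ * n + 1 : ℕ) : ℝ) :=
    (Nat.le_ceil _).trans (by exact_mod_cast (Nat.le_mul_of_pos_right _ hn).trans (Nat.le_succ _))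
  have hexp : Real.exp (-(n * (δ * h))) = Real.exp (n * δ) ^ (-h) := by
    rw [← Real.exp_mul]
    ring_nf
  rw [hexp]
  gcongr ?_ * ?_
  exact Real.rpow_le_rpow_of_nonpos (Real.exp_pos _) hle (by linarith)

end

variable {E V : Type*} [NormedAddCommGroup V] [InnerProductSpace ℝ V] [MeasurableSpace V]
  [BorelSpace V] {SΦ : ℕ → (ℕ → E) → V} {k : ℕ → ℕ} {l : V}

lemma ofReal_half_le_expMoment_empiricalLaw {n : ℕ} (hn : 1 ≤ n) (hk : 0 < k n) {x : ℕ → E}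
    {b w : ℝ} (hsum : k n * w / 2 ≤ ∑ j ∈ Finset.range (k n),
      min (Real.exp (inner ℝ l (SΦ n (shift^[j * n] x)))) b) :
    ENNReal.ofReal (w / 2) ≤ expMoment (empiricalLaw SΦ k x n) n l := by
  have hk0 : (0 : ℝ) < k n := by exact_mod_cast hk
  have hle : k n * (w / 2) ≤
      ∑ j ∈ Finset.range (k n), Real.exp (inner ℝ l (SΦ n (shift^[j * n] x))) := by
    rw [← mul_div_assoc]
    exact hsum.trans (Finset.sum_le_sum fun _ _ ↦ min_le_left _ _)
  rw [expMoment_empiricalLaw x hn, ← ENNReal.ofReal_sum_of_nonneg fun _ _ ↦ by positivity,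
    ← ENNReal.ofReal_natCast, ← ENNReal.ofReal_inv_of_pos hk0,
    ← ENNReal.ofReal_mul (by positivity)]
  exact ENNReal.ofReal_le_ofReal ((le_inv_mul_iff₀ hk0).2 hle)

variable {Ω : Type*} [MeasurableSpace Ω] [MeasurableSpace E] {P : Measure Ω}
  [IsProbabilityMeasure P] {X : ℕ → Ω → E} {p r s κ : ℝ}

lemma eventually_half_exp_le_integral_min_exp (hX : ∀ i, Measurable (X i))
    (hSΦ : ∀ n, 1 ≤ n → Measurable (SΦ n)) (hp : 1 ≤ p)
    (hr : (r : EReal) ≤ expGrowthInf fun n ↦ expMoment (scaledLaw P X SΦ n) n l)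
    (hs : expGrowthSup (fun n ↦ expMoment (scaledLaw P X SΦ n) n (p • l)) ≤ s)
    {b δ : ℝ} (hδ : 0 < δ) (hb : s + 2 * δ - (p - 1) * b < r) :
    ∀ᶠ n : ℕ in atTop, Real.exp (n * (r - δ)) / 2 ≤
      ∫ ω, min (Real.exp (inner ℝ l (SΦ n fun i ↦ X i ω))) (Real.exp (n * b)) ∂P := by
  have hrδ : ((r - δ : ℝ) : EReal) < r := EReal.coe_lt_coe_iff.2 (by linarith)
  have hsδ : (s : EReal) < ((s + δ : ℝ) : EReal) := EReal.coe_lt_coe_iff.2 (by linarith)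
  filter_upwards [eventually_exp_lt_of_lt_expGrowthInf (hrδ.trans_le hr),
    eventually_lt_exp_of_expGrowthSup_lt (hs.trans_lt hsδ), eventually_ge_atTop 1,
    eventually_const_mul_exp_le 2 (show s + δ - (p - 1) * b < r - δ by linarith)]
    with n hlow hhigh hn hAB
  rw [expMoment_scaledLaw hX hn (hSΦ n hn)] at hlow hhigh
  simp_rw [real_inner_smul_left] at hhigh
  refine half_le_integral_min_exp (B := Real.exp (n * (s + δ))) ?_ hp (Real.exp_pos _).le hlow.le
    hhigh.le ?_
  · exact (innerSL ℝ l).continuous.measurable.comp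
      ((hSΦ n hn).comp (measurable_pi_iff.2 hX))
  · rw [← Real.exp_add]
    convert hAB using 3
    ring

lemma measure_sum_min_exp_le_half_le (hX : ∀ i, Measurable (X i)) (hstat : IsStationary P X)
    (hSΦ : ∀ n, 1 ≤ n → Measurable (SΦ n)) (hdep : ∀ n, 1 ≤ n → DependsOnFirst (SΦ n) (2 * n))
    (hkpos : ∀ n, 1 ≤ n → 0 < k n) {n : ℕ} (hn : 1 ≤ n) (L : ℕ) {b w : ℝ} (hw : 0 < w)
    (hmean : ∫ ω, min (Real.exp (inner ℝ l (SΦ n fun i ↦ X i ω))) (Real.exp b) ∂P = w) :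
    P {ω | ∑ j ∈ Finset.range (k n), min (Real.exp (inner ℝ l (SΦ n
        (shift^[j * n] fun i ↦ X i ω)))) (Real.exp b) ≤ k n * w / 2} ≤
      ENNReal.ofReal (4 * ((2 * L + 3) * Real.exp b / (k n * w) +
        Real.exp b ^ 2 * mixingCoeff P X (L * n + 1) / w ^ 2)) :=
  measure_blockSum_le_half_le hX hstat
    (((innerSL ℝ l).continuous.measurable.comp (hSΦ n hn)).exp.min measurable_const)
    ((hdep n hn).comp_left fun y ↦ min (Real.exp (inner ℝ l y)) (Real.exp b))
    (fun _ ↦ by positivity) (fun _ ↦ min_le_right _ _) hn L hw hmean (hkpos n hn)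

lemma ae_eventually_exp_le_expMoment_empiricalLaw (hX : ∀ i, Measurable (X i))
    (hstat : IsStationary P X) (hSΦ : ∀ n, 1 ≤ n → Measurable (SΦ n))
    (hdep : ∀ n, 1 ≤ n → DependsOnFirst (SΦ n) (2 * n)) (hkpos : ∀ n, 1 ≤ n → 0 < k n)
    (hmix : ∀ h : ℝ, 0 < h → ∫⁻ u in Set.Icc (0 : ℝ) 1, mixingInv P X u ^ h < ⊤) (hp : 1 < p)
    (hr : (r : EReal) ≤ expGrowthInf fun n ↦ expMoment (scaledLaw P X SΦ n) n l)
    (hs : expGrowthSup (fun n ↦ expMoment (scaledLaw P X SΦ n) n (p • l)) ≤ s)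
    (hκ : ∀ᶠ n : ℕ in atTop, Real.exp (n * κ) ≤ k n) (hgap : s - p * r < (p - 1) * κ)
    {ε : ℝ} (hε : 0 < ε) :
    ∀ᵐ ω ∂P, ∀ᶠ n : ℕ in atTop, ENNReal.ofReal (Real.exp (n * (r - ε))) ≤
      expMoment (empiricalLaw SΦ k (fun i ↦ X i ω) n) n l := by
  obtain ⟨b, δ, h, hδ, hh, hδε, hb, hbκ, hbh⟩ := exists_truncation_parameters hp hgap hε
  obtain ⟨C, hC0, hC⟩ := exists_mixingCoeff_ceil_exp_le (P := P) X hh.le (hmix h hh) δ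
  set w : ℕ → ℝ := fun n ↦
    ∫ ω, min (Real.exp (inner ℝ l (SΦ n fun i ↦ X i ω))) (Real.exp (n * b)) ∂P
  have hw : ∀ᶠ n : ℕ in atTop, Real.exp (n * (r - δ)) / 2 ≤ w n :=
    eventually_half_exp_le_integral_min_exp hX hSΦ hp.le hr hs hδ hb
  have hprob : ∀ᶠ n : ℕ in atTop, P {ω | ∑ j ∈ Finset.range (k n),
      min (Real.exp (inner ℝ l (SΦ n (shift^[j * n] fun i ↦ X i ω)))) (Real.exp (n * b)) ≤
        k n * w n / 2} ≤ ENNReal.ofReal (4 * (14 + 4 * C) * Real.exp (n * -δ)) := by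
    filter_upwards [hw, hκ, eventually_ge_atTop 1] with n hwn hκn hn
    refine (measure_sum_min_exp_le_half_le hX hstat hSΦ hdep hkpos hn ⌈Real.exp (n * δ)⌉₊
      ((by positivity : (0 : ℝ) < _).trans_le hwn) rfl).trans (ENNReal.ofReal_le_ofReal ?_)
    rw [mul_assoc]
    gcongr
    exact chebyshev_exp_bound n.cast_nonneg hδ.le hC0 hbκ hbh hκn hwn (hC n hn)
  filter_upwards [ae_eventually_notMem_of_measure_le_exp hδ hprob] with ω hω
  filter_upwards [hω, hw, eventually_ge_atTop 1,
    eventually_const_mul_exp_le 4 (show r - ε < r - δ by linarith)] with n hsum hwn hn h4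
  refine (ENNReal.ofReal_le_ofReal ?_).trans
    (ofReal_half_le_expMoment_empiricalLaw hn (hkpos n hn) (not_le.1 hsum).le)
  linarith

lemma ae_le_expGrowthInf_expMoment_empiricalLaw_of_dependsOnFirst (hX : ∀ i, Measurable (X i))
    (hstat : IsStationary P X) (hSΦ : ∀ n, 1 ≤ n → Measurable (SΦ n))
    (hdep : ∀ n, 1 ≤ n → DependsOnFirst (SΦ n) (2 * n)) (hkpos : ∀ n, 1 ≤ n → 0 < k n)
    (hmix : ∀ h : ℝ, 0 < h → ∫⁻ u in Set.Icc (0 : ℝ) 1, mixingInv P X u ^ h < ⊤) (hp : 1 < p)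
    (hr : (r : EReal) ≤ expGrowthInf fun n ↦ expMoment (scaledLaw P X SΦ n) n l)
    (hs : expGrowthSup (fun n ↦ expMoment (scaledLaw P X SΦ n) n (p • l)) ≤ s)
    (hκ : ∀ᶠ n : ℕ in atTop, Real.exp (n * κ) ≤ k n) (hgap : s - p * r < (p - 1) * κ) :
    ∀ᵐ ω ∂P, (r : EReal) ≤
      expGrowthInf fun n ↦ expMoment (empiricalLaw SΦ k (fun i ↦ X i ω) n) n l := by
  have hrat : ∀ᵐ ω ∂P, ∀ q : {q : ℚ // (q : ℝ) < r}, (((q : ℚ) : ℝ) : EReal) ≤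
      expGrowthInf fun n ↦ expMoment (empiricalLaw SΦ k (fun i ↦ X i ω) n) n l := by
    refine ae_all_iff.2 fun q ↦ ?_
    filter_upwards [ae_eventually_exp_le_expMoment_empiricalLaw hX hstat hSΦ hdep hkpos hmix hp hr
      hs hκ hgap (sub_pos.2 q.2)] with ω hω
    simpa only [sub_sub_cancel] using le_expGrowthInf_of_eventually_exp_le hω
  filter_upwards [hrat] with ω hω
  by_contra! hlt
  obtain ⟨q, hωq, hqr⟩ := EReal.lt_iff_exists_rat_btwn.1 hlt
  exact (hω ⟨q, EReal.coe_lt_coe_iff.1 hqr⟩).not_gt hωq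

lemma ae_le_expGrowthInf_expMoment_empiricalLaw (hX : ∀ i, Measurable (X i))
    (hstat : IsStationary P X) (hSΦ : ∀ n, 1 ≤ n → Measurable (SΦ n)) {SΨ : ℕ → (ℕ → E) → V}
    (hdep : ∀ n, 1 ≤ n → DependsOnFirst (SΨ n) (2 * n)) (hclose : IsUniformlyClose SΦ SΨ)
    (hkpos : ∀ n, 1 ≤ n → 0 < k n)
    (hmix : ∀ h : ℝ, 0 < h → ∫⁻ u in Set.Icc (0 : ℝ) 1, mixingInv P X u ^ h < ⊤) (hp : 1 < p)
    (hr : (r : EReal) ≤ expGrowthInf fun n ↦ expMoment (scaledLaw P X SΦ n) n l)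
    (hs : expGrowthSup (fun n ↦ expMoment (scaledLaw P X SΦ n) n (p • l)) ≤ s)
    (hκ : ∀ᶠ n : ℕ in atTop, Real.exp (n * κ) ≤ k n) (hgap : s - p * r < (p - 1) * κ) :
    ∀ᵐ ω ∂P, (r : EReal) ≤
      expGrowthInf fun n ↦ expMoment (empiricalLaw SΦ k (fun i ↦ X i ω) n) n l := by
  obtain ⟨ω₀⟩ := nonempty_of_isProbabilityMeasure P
  -- `SΨ n` need not be measurable, but `SΦ n` of a truncated sequence is
  set SΦ' : ℕ → (ℕ → E) → V := fun n z ↦ SΦ n (truncSeq (X 0 ω₀) (2 * n) z)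
  have hmeas : ∀ n, 1 ≤ n → Measurable (SΦ' n) := fun n hn ↦
    (hSΦ n hn).comp (measurable_truncSeq _ _)
  have hclose' : IsUniformlyClose SΦ SΦ' := hclose.comp_truncSeq hdep (X 0 ω₀)
  have hdep' : ∀ n, 1 ≤ n → DependsOnFirst (SΦ' n) (2 * n) := fun n _ ↦
    (dependsOnFirst_truncSeq _ _).comp_left (SΦ n)
  have hr' := hr.trans <| expGrowthInf_le_of_forall_eventually_le_exp_mul fun _ hγ ↦
    hclose'.eventually_expMoment_scaledLaw_le hX hSΦ hmeas l hγ
  have hs' := (expGrowthSup_le_of_forall_eventually_le_exp_mul fun _ hγ ↦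
    hclose'.symm.eventually_expMoment_scaledLaw_le hX hmeas hSΦ (p • l) hγ).trans hs
  filter_upwards [ae_le_expGrowthInf_expMoment_empiricalLaw_of_dependsOnFirst hX hstat hmeas hdep'
    hkpos hmix hp hr' hs' hκ hgap] with ω hω
  exact hω.trans <| expGrowthInf_le_of_forall_eventually_le_exp_mul fun _ hγ ↦
    hclose'.symm.eventually_expMoment_empiricalLaw_le _ l hγ

end LowerBound

/-! ### Convergence of the logarithmic generating functions -/

section Convergence

variable {d : ℕ}

section Empirical

variable {E : Type*} {SΦ : ℕ → (ℕ → E) → EuclideanSpace ℝ (Fin d)} {k : ℕ → ℕ} {n : ℕ}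

lemma coe_toReal_logMGF_empiricalLaw (x : ℕ → E) (hn : 1 ≤ n) (hk : 0 < k n)
    (l : EuclideanSpace ℝ (Fin d)) :
    ((logMGF (empiricalLaw SΦ k x n) n l).toReal : EReal) =
      logMGF (empiricalLaw SΦ k x n) n l := by
  have htop : expMoment (empiricalLaw SΦ k x n) n l ≠ ⊤ := by
    rw [expMoment_empiricalLaw x hn]
    exact ENNReal.mul_ne_top (ENNReal.inv_ne_top.2 (by exact_mod_cast hk.ne'))
      (ENNReal.sum_ne_top.2 fun _ _ ↦ ENNReal.ofReal_ne_top)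
  have hzero : expMoment (empiricalLaw SΦ k x n) n l ≠ 0 := by
    rw [expMoment_empiricalLaw x hn]
    refine mul_ne_zero (ENNReal.inv_ne_zero.2 (ENNReal.natCast_ne_top _)) fun h ↦ ?_
    exact (ENNReal.ofReal_pos.2 (Real.exp_pos _)).ne'
      (Finset.sum_eq_zero_iff.1 h 0 (Finset.mem_range.2 hk))
  have hlog : logMGF (empiricalLaw SΦ k x n) n l =
      ((Real.log (expMoment (empiricalLaw SΦ k x n) n l).toReal / n : ℝ) : EReal) := by
    rw [EReal.coe_div, ← ENNReal.log_pos_real hzero htop]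
    rfl
  rw [hlog, EReal.toReal_coe]

lemma convexOn_toReal_logMGF_empiricalLaw (x : ℕ → E) (hn : 1 ≤ n) (hk : 0 < k n) :
    ConvexOn ℝ Set.univ fun l ↦ (logMGF (empiricalLaw SΦ k x n) n l).toReal := by
  have hcoe := coe_toReal_logMGF_empiricalLaw (SΦ := SΦ) x hn hk
  have hdom : effDomain (logMGF (empiricalLaw SΦ k x n) n) = Set.univ :=
    Set.eq_univ_of_forall fun l ↦ (hcoe l ▸ EReal.coe_lt_top _ : _ < ⊤)
  rw [← hdom]
  exact (isEConvex_logMGF _ hn).convexOn_toReal fun l ↦ hcoe l ▸ EReal.coe_ne_bot _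

end Empirical

variable {Λ : EuclideanSpace ℝ (Fin d) → EReal}

/- Let `x` be a subgradient of `Λ` at `p • l`. Since `Λ*` is finite at `x`, both
`Λ (p • l) - Λ l ≤ (p - 1) ⟨l, x⟩` and `p ⟨l, x⟩ - Λ (p • l) = Λ* x ≤ c`; eliminate `⟨l, x⟩`. -/
lemma IsEConvex.toReal_smul_sub_le (hconv : IsEConvex Λ) (hbot : ∀ l, Λ l ≠ ⊥) {p c : ℝ}
    (hp : 1 ≤ p) {l : EuclideanSpace ℝ (Fin d)} (hl : l ∈ interior (effDomain Λ))
    (hpl : p • l ∈ interior (effDomain Λ)) (hc : ∀ x ∈ effDomain (fenchel Λ), fenchel Λ x ≤ c) :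
    (Λ (p • l)).toReal - p * (Λ l).toReal ≤ (p - 1) * c := by
  have hf : ConvexOn ℝ (interior (effDomain Λ)) fun m ↦ (Λ m).toReal :=
    (hconv.convexOn_toReal hbot).subset interior_subset hconv.convex_effDomain.interior
  obtain ⟨φ, hφ⟩ := exists_continuousLinearMap_forall_add_le isOpen_interior hf
    (hf.continuousOn isOpen_interior) hpl
  set x := (InnerProductSpace.toDual ℝ (EuclideanSpace ℝ (Fin d))).symm φ
  have hx : ∀ m ∈ interior (effDomain Λ),
      (Λ (p • l)).toReal + (inner ℝ m x - p * inner ℝ l x) ≤ (Λ m).toReal := by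
    intro m hm
    have h := hφ m hm
    rwa [← InnerProductSpace.toDual_symm_apply, real_inner_comm, inner_sub_left,
      real_inner_smul_left] at h
  have hle : fenchel Λ x ≤ ((p * inner ℝ l x - (Λ (p • l)).toReal : ℝ) : EReal) := by
    by_contra! hlt
    obtain ⟨m, hm, hlt'⟩ := hconv.exists_mem_interior_lt hbot ⟨l, hl⟩ hlt
    linarith [hx m hm]
  have hxc : p * inner ℝ l x - (Λ (p • l)).toReal ≤ c := by
    rw [← real_inner_smul_left, ← EReal.coe_le_coe_iff]
    exact (coe_inner_sub_toReal_le_fenchel hbot (interior_subset hpl) x).trans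
      (hc x (hle.trans_lt (EReal.coe_lt_top _)))
  linarith [mul_le_mul_of_nonneg_left (hx l hl) (zero_le_one.trans hp),
    mul_le_mul_of_nonneg_left hxc (sub_nonneg.2 hp)]

lemma eventually_exp_le_of_eventually_le_log_div {k : ℕ → ℕ} (hkpos : ∀ n, 1 ≤ n → 0 < k n)
    {κ : ℝ} (h : ∀ᶠ n : ℕ in atTop, κ ≤ Real.log (k n) / n) :
    ∀ᶠ n : ℕ in atTop, Real.exp (n * κ) ≤ k n := by
  filter_upwards [h, eventually_ge_atTop 1] with n hκ hn
  rw [← Real.le_log_iff_exp_le (by exact_mod_cast hkpos n hn), mul_comm]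
  exact (le_div_iff₀ (by exact_mod_cast hn)).1 hκ

lemma exists_moment_gap (hconv : IsEConvex Λ) (hbot : ∀ l, Λ l ≠ ⊥) {k : ℕ → ℕ}
    (hkpos : ∀ n, 1 ≤ n → 0 < k n)
    (hk : (⨆ x ∈ effDomain (fenchel Λ), fenchel Λ x) <
        liminf (fun n : ℕ ↦ ((Real.log (k n) / n : ℝ) : EReal)) atTop ∨
      Tendsto (fun n : ℕ ↦ Real.log (k n) / n) atTop atTop)
    {l : EuclideanSpace ℝ (Fin d)} (hl : l ∈ interior (effDomain Λ)) :
    ∃ p κ : ℝ, 1 < p ∧ p • l ∈ effDomain Λ ∧ (∀ᶠ n : ℕ in atTop, Real.exp (n * κ) ≤ k n) ∧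
      (Λ (p • l)).toReal - p * (Λ l).toReal < (p - 1) * κ := by
  have hcont : Tendsto (fun p : ℝ ↦ p • l) (𝓝[>] 1) (𝓝 l) :=
    (Continuous.tendsto' (by fun_prop) 1 l (one_smul ℝ l)).mono_left nhdsWithin_le_nhds
  obtain ⟨p, hpl, hp : 1 < p⟩ :=
    ((hcont.eventually (isOpen_interior.mem_nhds hl)).and self_mem_nhdsWithin).exists
  have hp' : 0 < p - 1 := sub_pos.2 hp
  suffices ∃ κ : ℝ, (∀ᶠ n : ℕ in atTop, κ ≤ Real.log (k n) / n) ∧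
      (Λ (p • l)).toReal - p * (Λ l).toReal < (p - 1) * κ by
    obtain ⟨κ, hκ, hgap⟩ := this
    exact ⟨p, κ, hp, interior_subset hpl,
      eventually_exp_le_of_eventually_le_log_div hkpos hκ, hgap⟩
  rcases hk with hlt | htop
  · obtain ⟨κ, hsup, hκ⟩ := EReal.lt_iff_exists_real_btwn.1 hlt
    obtain ⟨c, hc, hcκ⟩ := EReal.lt_iff_exists_real_btwn.1 hsup
    refine ⟨κ, (eventually_lt_of_lt_liminf hκ).mono fun n hn ↦ (EReal.coe_lt_coe_iff.1 hn).le, ?_⟩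
    refine (hconv.toReal_smul_sub_le hbot hp.le hl hpl fun x hx ↦
      (le_iSup₂ (f := fun x _ ↦ fenchel Λ x) x hx).trans hc.le).trans_lt ?_
    exact mul_lt_mul_of_pos_left (EReal.coe_lt_coe_iff.1 hcκ) hp'
  · refine ⟨((Λ (p • l)).toReal - p * (Λ l).toReal) / (p - 1) + 1, htop.eventually_ge_atTop _, ?_⟩
    rw [mul_add, mul_div_cancel₀ _ hp'.ne']
    linarith

section Uniform

variable {E : Type*} {SΦ : ℕ → (ℕ → E) → EuclideanSpace ℝ (Fin d)} {k : ℕ → ℕ}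

lemma tendstoUniformlyOn_toReal_logMGF_empiricalLaw (hconv : IsEConvex Λ) (hbot : ∀ l, Λ l ≠ ⊥)
    (hkpos : ∀ n, 1 ≤ n → 0 < k n) {x : ℕ → E} {D K : Set (EuclideanSpace ℝ (Fin d))}
    (hDU : D ⊆ interior (effDomain Λ)) (hUD : interior (effDomain Λ) ⊆ closure D)
    (hlim : ∀ l ∈ D, Tendsto (fun n : ℕ ↦ logMGF (empiricalLaw SΦ k x n) n l) atTop (𝓝 (Λ l)))
    (hK : IsCompact K) (hKU : K ⊆ interior (effDomain Λ)) :
    TendstoUniformlyOn (fun (n : ℕ) l ↦ (logMGF (empiricalLaw SΦ k x n) n l).toReal)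
      (fun l ↦ (Λ l).toReal) atTop K := by
  have hconvex := hconv.convex_effDomain.interior
  have hcont : ContinuousOn (fun l ↦ (Λ l).toReal) (interior (effDomain Λ)) :=
    ((hconv.convexOn_toReal hbot).subset interior_subset hconvex).continuousOn isOpen_interior
  refine tendstoUniformlyOn_of_tendsto_dense isOpen_interior hDU hUD ?_ hcont (fun l hl ↦ ?_) hK hKU
  · filter_upwards [eventually_ge_atTop 1] with n hn
    exact (convexOn_toReal_logMGF_empiricalLaw x hn (hkpos n hn)).subset (Set.subset_univ _) hconvex
  · have hlD : l ∈ effDomain Λ := interior_subset (hDU hl)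
    exact (EReal.tendsto_toReal (ne_of_lt hlD) (hbot l)).comp (hlim l hl)

lemma tendsto_logMGF_empiricalLaw_of_tendsto_toReal (hbot : ∀ l, Λ l ≠ ⊥)
    (hkpos : ∀ n, 1 ≤ n → 0 < k n) {x : ℕ → E} {l : EuclideanSpace ℝ (Fin d)}
    (hl : l ∈ effDomain Λ)
    (h : Tendsto (fun n : ℕ ↦ (logMGF (empiricalLaw SΦ k x n) n l).toReal) atTop
      (𝓝 (Λ l).toReal)) :
    Tendsto (fun n : ℕ ↦ logMGF (empiricalLaw SΦ k x n) n l) atTop (𝓝 (Λ l)) := by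
  rw [← coe_toReal_of_mem_effDomain hbot hl]
  refine ((continuous_coe_real_ereal.tendsto _).comp h).congr' ?_
  filter_upwards [eventually_ge_atTop 1] with n hn
  exact coe_toReal_logMGF_empiricalLaw x hn (hkpos n hn) l

lemma ae_tendstoUniformlyOn_toReal_logMGF_empiricalLaw {Ω : Type*} [MeasurableSpace Ω]
    {P : Measure Ω} {X : ℕ → Ω → E} (hconv : IsEConvex Λ) (hbot : ∀ l, Λ l ≠ ⊥)
    (hkpos : ∀ n, 1 ≤ n → 0 < k n)
    (h : ∀ l ∈ interior (effDomain Λ), ∀ᵐ ω ∂P, Tendsto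
      (fun n : ℕ ↦ logMGF (empiricalLaw SΦ k (fun i ↦ X i ω) n) n l) atTop (𝓝 (Λ l))) :
    ∀ᵐ ω ∂P, ∀ K : Set (EuclideanSpace ℝ (Fin d)), IsCompact K → K ⊆ interior (effDomain Λ) →
      TendstoUniformlyOn
        (fun (n : ℕ) l ↦ (logMGF (empiricalLaw SΦ k (fun i ↦ X i ω) n) n l).toReal)
        (fun l ↦ (Λ l).toReal) atTop K := by
  obtain ⟨D, hDc, hD⟩ := TopologicalSpace.exists_countable_dense (EuclideanSpace ℝ (Fin d))
  filter_upwards [(ae_ball_iff (hDc.mono Set.inter_subset_right)).2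
    fun l (hl : l ∈ interior (effDomain Λ) ∩ D) ↦ h l hl.1] with ω hω K hK hKU
  exact tendstoUniformlyOn_toReal_logMGF_empiricalLaw hconv hbot hkpos Set.inter_subset_left
    (hD.open_subset_closure_inter isOpen_interior) hω hK hKU

end Uniform

section AlmostSure

open ExpGrowth

variable {Ω E : Type*} [MeasurableSpace Ω] [MeasurableSpace E] {P : Measure Ω}
  [IsProbabilityMeasure P] {X : ℕ → Ω → E} {SΦ : ℕ → (ℕ → E) → EuclideanSpace ℝ (Fin d)}

lemma eq_zero_of_tendsto_logMGF_scaledLaw (hX : ∀ i, Measurable (X i))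
    (hSΦ : ∀ n, 1 ≤ n → Measurable (SΦ n)) {a : EReal}
    (h : Tendsto (fun n : ℕ ↦ logMGF (scaledLaw P X SΦ n) n 0) atTop (𝓝 a)) : a = 0 := by
  refine tendsto_nhds_unique h (tendsto_const_nhds.congr' ?_)
  filter_upwards [eventually_ge_atTop 1] with n hn
  have : IsProbabilityMeasure (scaledLaw P X SΦ n) := Measure.isProbabilityMeasure_map
    (((hSΦ n hn).comp (measurable_pi_iff.2 hX)).const_smul (n : ℝ)⁻¹).aemeasurable
  rw [logMGF_zero]

lemma ae_tendsto_logMGF_empiricalLaw (hX : ∀ i, Measurable (X i)) (hstat : IsStationary P X)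
    (hSΦ : ∀ n, 1 ≤ n → Measurable (SΦ n)) {SΨ : ℕ → (ℕ → E) → EuclideanSpace ℝ (Fin d)}
    (hdep : ∀ n, 1 ≤ n → DependsOnFirst (SΨ n) (2 * n)) (hclose : IsUniformlyClose SΦ SΨ)
    {k : ℕ → ℕ} (hkpos : ∀ n, 1 ≤ n → 0 < k n)
    (hmix : ∀ h : ℝ, 0 < h → ∫⁻ u in Set.Icc (0 : ℝ) 1, mixingInv P X u ^ h < ⊤)
    (hΛ : ∀ l, Tendsto (fun n : ℕ ↦ logMGF (scaledLaw P X SΦ n) n l) atTop (𝓝 (Λ l)))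
    (hbot : ∀ l, Λ l ≠ ⊥) {l : EuclideanSpace ℝ (Fin d)} {p κ : ℝ} (hp : 1 < p)
    (hl : l ∈ effDomain Λ) (hpl : p • l ∈ effDomain Λ)
    (hκ : ∀ᶠ n : ℕ in atTop, Real.exp (n * κ) ≤ k n)
    (hgap : (Λ (p • l)).toReal - p * (Λ l).toReal < (p - 1) * κ) :
    ∀ᵐ ω ∂P, Tendsto
      (fun n : ℕ ↦ logMGF (empiricalLaw SΦ k (fun i ↦ X i ω) n) n l) atTop (𝓝 (Λ l)) := by
  have hr : ((Λ l).toReal : EReal) ≤ expGrowthInf fun n ↦ expMoment (scaledLaw P X SΦ n) n l :=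
    (coe_toReal_of_mem_effDomain hbot hl).trans_le (hΛ l).liminf_eq.ge
  have hs : expGrowthSup (fun n ↦ expMoment (scaledLaw P X SΦ n) n (p • l)) ≤
      ((Λ (p • l)).toReal : EReal) :=
    (hΛ (p • l)).limsup_eq.le.trans_eq (coe_toReal_of_mem_effDomain hbot hpl).symm
  filter_upwards [ae_expGrowthSup_expMoment_empiricalLaw_le hX hstat hSΦ hkpos l,
    ae_le_expGrowthInf_expMoment_empiricalLaw hX hstat hSΦ hdep hclose hkpos hmix hp hr hs hκ
      hgap] with ω hsup hinf
  exact tendsto_of_le_liminf_of_limsup_le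
    ((coe_toReal_of_mem_effDomain hbot hl).symm.trans_le hinf)
    (hsup.trans (hΛ l).limsup_eq.le)

end AlmostSure

end Convergence

end LocalFluctuations

theorem corollary2p1_general
    {Ω E : Type*} [MeasurableSpace Ω] [MeasurableSpace E]
    (P : Measure Ω) [IsProbabilityMeasure P]
    (X : ℕ → Ω → E) (hX : ∀ i, Measurable (X i)) (hstat : IsStationary P X)
    (d : ℕ) (SΦ : ℕ → (ℕ → E) → EuclideanSpace ℝ (Fin d))
    (hSΦ : ∀ n, 1 ≤ n → Measurable (SΦ n))
    (k : ℕ → ℕ) (hkpos : ∀ n, 1 ≤ n → 0 < k n)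
    (Λ : EuclideanSpace ℝ (Fin d) → EReal)
    (hΛ : ∀ l, Tendsto (fun n : ℕ ↦ logMGF (scaledLaw P X SΦ n) n l) atTop (𝓝 (Λ l)))
    (hΛ0 : (0 : EuclideanSpace ℝ (Fin d)) ∈ interior (effDomain Λ))
    (hmix : ∀ h : ℝ, 0 < h → ∫⁻ u in Set.Icc (0 : ℝ) 1, (mixingInv P X u) ^ h < ⊤)
    (happrox : ∃ g : ℕ → (ℕ → E) → EuclideanSpace ℝ (Fin d),
      (∀ n, 1 ≤ n → DependsOnFirst (g n) (2 * n)) ∧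
      Tendsto (fun n : ℕ ↦ (⨆ z : ℕ → E, ‖SΦ n z - g n z‖ₑ) / (n : ℝ≥0∞)) atTop (𝓝 0))
    (hk : ((⨆ x ∈ effDomain (fenchel Λ), fenchel Λ x) < ⊤ ∧
        (⨆ x ∈ effDomain (fenchel Λ), fenchel Λ x) <
          liminf (fun n : ℕ ↦ ((Real.log (k n) / n : ℝ) : EReal)) atTop) ∨
      Tendsto (fun n : ℕ ↦ Real.log (k n) / n) atTop atTop) :
    (∀ l, Λ l ≠ ⊥) ∧
    ∀ᵐ ω ∂P,
      (∀ K : Set (EuclideanSpace ℝ (Fin d)), IsCompact K → K ⊆ interior (effDomain Λ) →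
        TendstoUniformlyOn
          (fun (n : ℕ) l => (logMGF (empiricalLaw SΦ k (fun i => X i ω) n) n l).toReal)
          (fun l => (Λ l).toReal) atTop K) ∧
      (∀ F : Set (EuclideanSpace ℝ (Fin d)), IsClosed F →
        limsup (fun n : ℕ ↦
          ENNReal.log (empiricalLaw SΦ k (fun i => X i ω) n F) / (n : EReal)) atTop
          ≤ -(⨅ x ∈ F, fenchel Λ x)) ∧
      (∀ G : Set (EuclideanSpace ℝ (Fin d)), IsOpen G →
        -(⨅ x ∈ G ∩ exposedPoints Λ, fenchel Λ x) ≤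
          liminf (fun n : ℕ ↦
            ENNReal.log (empiricalLaw SΦ k (fun i => X i ω) n G) / (n : EReal)) atTop) ∧
      (EssentiallySmooth Λ → LowerSemicontinuous Λ →
        IsGoodRateFunction (fenchel Λ) ∧
        SatisfiesLDP (fun n => empiricalLaw SΦ k (fun i => X i ω) n) (fenchel Λ)) := by
  have hconv : IsEConvex Λ :=
    isEConvex_of_tendsto ((eventually_ge_atTop 1).mono fun n hn ↦ isEConvex_logMGF _ hn) hΛ
  have h0 : Λ 0 = 0 := eq_zero_of_tendsto_logMGF_scaledLaw hX hSΦ (hΛ 0)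
  have hbot : ∀ l, Λ l ≠ ⊥ := hconv.ne_bot hΛ0 (h0.trans_ne EReal.zero_ne_bot)
  refine ⟨hbot, ?_⟩
  obtain ⟨g, hdep, hg⟩ := happrox
  have hpointwise : ∀ l ∈ interior (effDomain Λ), ∀ᵐ ω ∂P, Tendsto
      (fun n : ℕ ↦ logMGF (empiricalLaw SΦ k (fun i ↦ X i ω) n) n l) atTop (𝓝 (Λ l)) := by
    intro l hl
    obtain ⟨p, κ, hp, hpl, hκ, hgap⟩ :=
      exists_moment_gap hconv hbot hkpos (hk.imp_left And.right) hl
    exact ae_tendsto_logMGF_empiricalLaw hX hstat hSΦ hdep (isUniformlyClose_of_tendsto_iSup_div hg)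
      hkpos hmix hΛ hbot hp (interior_subset hl) hpl hκ hgap
  filter_upwards [ae_tendstoUniformlyOn_toReal_logMGF_empiricalLaw hconv hbot hkpos hpointwise]
    with ω hunif
  have hlim : ∀ l ∈ interior (effDomain Λ), Tendsto
      (fun n : ℕ ↦ logMGF (empiricalLaw SΦ k (fun i ↦ X i ω) n) n l) atTop (𝓝 (Λ l)) := fun l hl ↦
    tendsto_logMGF_empiricalLaw_of_tendsto_toReal hbot hkpos (interior_subset hl)
      ((hunif {l} isCompact_singleton (Set.singleton_subset_iff.2 hl)).tendsto_at rfl)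
  exact ⟨hunif, fun F hF ↦ hconv.expGrowthSup_le_of_isClosed hbot hΛ0 hlim hF,
    fun G hG ↦ hconv.le_expGrowthInf_of_isOpen hbot hlim hG, fun hsm hlsc ↦
      ⟨isGoodRateFunction_fenchel hbot h0.le hΛ0,
        satisfiesLDP_fenchel hconv hbot h0.le hΛ0 hlim hsm hlsc⟩⟩

theorem corollary2p1
    {Ω E : Type*} [MeasurableSpace Ω] [MeasurableSpace E]
    (P : Measure Ω) [IsProbabilityMeasure P]
    -- the stationary process
    (X : ℕ → Ω → E) (hX : ∀ i, Measurable (X i)) (hstat : IsStationary P X)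
    -- the functionals `S_n Φ`
    (d : ℕ) (hd : 1 ≤ d) (SΦ : ℕ → (ℕ → E) → EuclideanSpace ℝ (Fin d))
    (hSΦ : ∀ n, 1 ≤ n → Measurable (SΦ n))
    -- the number of blocks
    (k : ℕ → ℕ) (hkpos : ∀ n, 1 ≤ n → 0 < k n) (hkmono : MonotoneOn k (Set.Ici 1))
    -- the limiting logarithmic generating function exists and is finite near the origin
    (Λ : EuclideanSpace ℝ (Fin d) → EReal)
    (hΛ : ∀ l, Tendsto (fun n : ℕ => logMGF (scaledLaw P X SΦ n) n l) atTop (𝓝 (Λ l)))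
    (hΛ0 : (0 : EuclideanSpace ℝ (Fin d)) ∈ interior (effDomain Λ))
    -- mixing
    (hmix : ∀ h : ℝ, 0 < h → ∫⁻ u in Set.Icc (0 : ℝ) 1, (mixingInv P X u) ^ h < ⊤)
    -- approximation by functions of the first `2n` coordinates
    (happrox : ∃ g : ℕ → (ℕ → E) → EuclideanSpace ℝ (Fin d),
      (∀ n, 1 ≤ n → DependsOnFirst (g n) (2 * n)) ∧
      Tendsto (fun n : ℕ => (⨆ z : ℕ → E, ‖SΦ n z - g n z‖ₑ) / (n : ℝ≥0∞)) atTop (𝓝 0))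
    -- growth of the number of blocks
    (hk : ((⨆ x ∈ effDomain (fenchel Λ), fenchel Λ x) < ⊤ ∧
        (⨆ x ∈ effDomain (fenchel Λ), fenchel Λ x) <
          liminf (fun n : ℕ => ((Real.log (k n) / n : ℝ) : EReal)) atTop) ∨
      Tendsto (fun n : ℕ => Real.log (k n) / n) atTop atTop) :
    -- `Λ` does not take the value `-∞`, so that it is real-valued on its domain
    (∀ l, Λ l ≠ ⊥) ∧
    ∀ᵐ ω ∂P,
      -- uniform convergence on the compact subsets of the interior of the domain
      (∀ K : Set (EuclideanSpace ℝ (Fin d)), IsCompact K → K ⊆ interior (effDomain Λ) →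
        TendstoUniformlyOn
          (fun (n : ℕ) l => (logMGF (empiricalLaw SΦ k (fun i => X i ω) n) n l).toReal)
          (fun l => (Λ l).toReal) atTop K) ∧
      -- upper bound for closed sets
      (∀ F : Set (EuclideanSpace ℝ (Fin d)), IsClosed F →
        limsup (fun n : ℕ =>
          ENNReal.log (empiricalLaw SΦ k (fun i => X i ω) n F) / (n : EReal)) atTop
          ≤ -(⨅ x ∈ F, fenchel Λ x)) ∧
      -- lower bound for open sets
      (∀ G : Set (EuclideanSpace ℝ (Fin d)), IsOpen G →
        -(⨅ x ∈ G ∩ exposedPoints Λ, fenchel Λ x) ≤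
          liminf (fun n : ℕ =>
            ENNReal.log (empiricalLaw SΦ k (fun i => X i ω) n G) / (n : EReal)) atTop) ∧
      -- full large deviation principle
      (EssentiallySmooth Λ → LowerSemicontinuous Λ →
        IsGoodRateFunction (fenchel Λ) ∧
        SatisfiesLDP (fun n => empiricalLaw SΦ k (fun i => X i ω) n) (fenchel Λ)) := by
  exact corollary2p1_general P X hX hstat d SΦ hSΦ k hkpos Λ hΛ hΛ0 hmix happrox hk
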